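/- For integers $n$ and $r$, let $[n]=\{1,\dots,n\}$ and let $\binom{[n]}{r}$ be the set of $r$-element subsets of $[n]$. A family $\mathcal F\subseteq\binom{[n]}{r}$ is intersecting if any two of its members have a non-empty intersection; $\Delta(\mathcal F)$ is the maximum, over $x\in[n]$, of the number of members of $\mathcal F$ containing $x$; and for real $C$ the $C$-weighted diversity of $\mathcal F$ is $d_C(\mathcal F)=|\mathcal F|-C\cdot\Delta(\mathcal F)$. Two families on $[n]$ are isomorphic if a permutation of $[n]$ carries one onto the other. Let $$\mathbb F=\{124,137,156,235,267,346,457\}$$ be the Fano plane on $[7]$ (where $abc$ denotes $\{a,b,c\}$), let $\mathbb F^+$ be the union of $\mathbb F$ with the set of all $4$-element subsets of $[7]$ that meet every member of $\mathbb F$, and put $$\mathcal A_{\mathbb F}=\Big\{E\in\tbinom{[n]}{r}:E\cap[7]\in\mathbb F\Big\},\qquad \mathcal A_{\mathbb F^+}=\Big\{E\in\tbinom{[n]}{r}:E\cap[7]\in\mathbb F^+\Big\}.$$ Binomial coefficients with a negative lower entry are $0$. Fix an integer $r\ge 3$ and a real number $C$ with $\frac32\le C<\frac73$. There is $n_0=n_0(r,C)$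 such that for all $n\ge n_0$ and every intersecting family $\mathcal F\subseteq\binom{[n]}{r}$ the following holds. 1. If $\frac32\le C<\frac74$, then $$d_C(\mathcal F)\le(7-3C)\binom{n-7}{r-3}+(28-16C)\binom{n-7}{r-4}.$$ Equality holds whenever $\mathcal F$ is isomorphic to $\mathcal A_{\mathbb F^+}$; and, unless $r=3$ and $C=\frac32$, equality holds only if $\mathcal F$ is isomorphic to $\mathcal A_{\mathbb F^+}$. 2. If $\frac74\le C<\frac73$, then $$d_C(\mathcal F)\le(7-3C)\binom{n-7}{r-3},$$ and, if $C\ne\frac74$, equality holds if and only if $\mathcal F$ is isomorphic to $\mathcal A_{\mathbb F}$. -/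

import Mathlib

namespace WeightedDiversity

open Finset

/-- The ground set `[n] = {1, …, n}`. -/
def ground (n : ℕ) : Finset ℕ := Icc 1 n

/-- `F` is an intersecting family of `r`-element subsets of `[n]`. -/
def IsIntersectingFamily (n r : ℕ) (F : Finset (Finset ℕ)) : Prop :=
  F ⊆ powersetCard r (ground n) ∧ (F : Set (Finset ℕ)).Intersecting

/-- The degree of the vertex `x`: the number of edges of `F` containing `x`. -/
def degree (F : Finset (Finset ℕ)) (x : ℕ) : ℕ := #{E ∈ F | x ∈ E}

/-- The maximum degree `Δ(F)` of a family on `[n]`. -/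
def maxDegree (n : ℕ) (F : Finset (Finset ℕ)) : ℕ := (ground n).sup (degree F)

/-- The `C`-weighted diversity `d_C(F) = |F| - C · Δ(F)` of a family on `[n]`. -/
noncomputable def diversity (n : ℕ) (C : ℝ) (F : Finset (Finset ℕ)) : ℝ :=
  (#F : ℝ) - C * (maxDegree n F : ℝ)

/-- Families on `[n]` are isomorphic if a permutation of `[n]` carries one onto the other. -/
def Isomorphic (n : ℕ) (F G : Finset (Finset ℕ)) : Prop :=
  ∃ σ : Equiv.Perm ℕ, (ground n).image σ = ground n ∧ F.image (fun E => E.image σ) = G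

/-- The Fano plane on `[7]`. -/
def fano : Finset (Finset ℕ) :=
  {{1, 2, 4}, {1, 3, 7}, {1, 5, 6}, {2, 3, 5}, {2, 6, 7}, {3, 4, 6}, {4, 5, 7}}

/-- The complements in `[7]` of the edges of the Fano plane. -/
def fanoCompl : Finset (Finset ℕ) := fano.image (fun L => ground 7 \ L)

/-- The Fano plane together with all 4-subsets of `[7]` that meet every one of its edges, that is,
all 4-subsets that are not complements of its edges. -/
def fanoPlus : Finset (Finset ℕ) := fano ∪ (powersetCard 4 (ground 7) \ fanoCompl)

/-- The `r`-subsets of `[n]` whose intersection with `[7]` belongs to `B`. -/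
def traceFamily (n r : ℕ) (B : Finset (Finset ℕ)) : Finset (Finset ℕ) :=
  {E ∈ powersetCard r (ground n) | E ∩ ground 7 ∈ B}

/-- The family `A_𝔽`. -/
def fanoFamily (n r : ℕ) : Finset (Finset ℕ) := traceFamily n r fano

/-- The family `A_𝔽⁺`. -/
def fanoPlusFamily (n r : ℕ) : Finset (Finset ℕ) := traceFamily n r fanoPlus

/-- The binomial coefficient with an integer lower entry, equal to `0` if that entry is negative. -/
def binom (m : ℕ) (k : ℤ) : ℕ := if 0 ≤ k then m.choose k.toNat else 0

end WeightedDiversity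

open WeightedDiversity

open WeightedDiversity

namespace WeightedDiversity

open Finset

/-! ### Kernels of intersecting families -/

/-! Write N = `binom (n - 7) (r - 3)`, B = `binom (n - 7) (r - 4)` and Δ for the maximum degree. Any
two members of an intersecting family already meet inside a kernel J of size bounded in terms of r
(`exists_kernel`). For large n at most εN members meet J in four or more points
(`eventually_small`); call the remaining members F'. Everything else is double counting: the sum of
|E ∩ W| over E is at most |W|Δ.

Two bounds, |F'| - (3/2)Δ ≤ 2.3N and |F'| ≤ (7/3)Δ, put the diversity strictly below (7 - 3C)N
(`sub_mul_lt_of_bounds`). They hold if two points cover F' (`two_cover_bound`). Otherwise all traces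
of F' on J are triples, and the bounds hold if there are at most six traces (`few_traces_bound`). If
two traces share two points, then all traces lie in six points or all meet some 4-set twice
(`six_points_or_quad`); the bounds follow again, except for ten triples on six points. That
configuration ties with the Fano plane to first order at C = 3/2, where an exact count gives (5/2)(N
+ B), against (5/2)N + 4B for the extremal family. This is why r = 3, C = 3/2 is special.

What remains is a linear system of at least seven triples, which is a Fano plane (`linear_eq_fano`),
and every member of the whole family meets all its lines. Let a, b, c count the members whose trace
on the plane is a line, a blocking 4-set, or has at least five points. Then 3a + 4b + 5c ≤ 7Δ
(`fano_count`), so 7 times the diversity is at most (7 - 3C)a + (7 - 4C)b + (7 - 5C)c. With a ≤ 7N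
and b ≤ 28B, the signs of these coefficients give both the bounds and the equality cases. -/

theorem exists_cross_kernel (k : ℕ) : ∃ M : ℕ, ∀ A B : Finset (Finset ℕ),
    (∀ E ∈ A, #E ≤ k) → (∀ E ∈ B, #E ≤ k) → (∀ E ∈ A, ∀ E' ∈ B, (E ∩ E').Nonempty) →
    ∃ J : Finset ℕ, #J ≤ M ∧ ∀ E ∈ A, ∀ E' ∈ B, (E ∩ E' ∩ J).Nonempty := by
  induction k with
  | zero =>
    refine ⟨0, fun A B hA _ hAB => ⟨∅, by simp, fun E hE E' hE' => ?_⟩⟩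
    have h0 : E = ∅ := by simpa using hA E hE
    have := hAB E hE E' hE'
    simp [h0] at this
  | succ k ih =>
    obtain ⟨M, hM⟩ := ih
    refine ⟨2 * (k + 1) + 2 ^ (2 * (k + 1)) * 2 ^ (2 * (k + 1)) * M, fun A B hA hB hAB => ?_⟩
    rcases A.eq_empty_or_nonempty with rfl | ⟨E₀, hE₀⟩
    · exact ⟨∅, by simp, by simp⟩
    rcases B.eq_empty_or_nonempty with rfl | ⟨E₁, hE₁⟩
    · exact ⟨∅, by simp, by simp⟩
    -- Every member of either family meets S, so deleting S lowers the sizes to at most k. Members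
    -- with disjoint traces on S still cross-intersect outside S. The induction therefore runs on
    -- pairs of trace classes, which is why two families are needed.
    set S := E₀ ∪ E₁ with hS
    have hScard : #S ≤ 2 * (k + 1) := by
      have := card_union_le E₀ E₁
      have := hA _ hE₀
      have := hB _ hE₁
      rw [hS]
      omega
    have key : ∀ p : Finset ℕ × Finset ℕ, ∃ J : Finset ℕ, #J ≤ M ∧
        ∀ E ∈ A, ∀ E' ∈ B, E ∩ S = p.1 → E' ∩ S = p.2 → Disjoint p.1 p.2 →
          (E ∩ E' ∩ J).Nonempty := by
      intro p
      by_cases hd : Disjoint p.1 p.2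
      · have hM' := hM ({E ∈ A | E ∩ S = p.1}.image (· \ S))
          ({E ∈ B | E ∩ S = p.2}.image (· \ S)) ?_ ?_ ?_
        · obtain ⟨J, hJ, h⟩ := hM'
          refine ⟨J, hJ, fun E hE E' hE' h1 h2 _ => ?_⟩
          obtain ⟨x, hx⟩ := h (E \ S) (mem_image_of_mem _ (mem_filter.2 ⟨hE, h1⟩)) (E' \ S)
            (mem_image_of_mem _ (mem_filter.2 ⟨hE', h2⟩))
          exact ⟨x, by simp only [mem_inter, mem_sdiff] at hx ⊢; tauto⟩
        · simp only [mem_image, mem_filter, forall_exists_index, and_imp]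
          rintro _ E hE - rfl
          obtain ⟨x, hx⟩ := hAB E hE E₁ hE₁
          have : E \ S ⊂ E := by
            refine ⟨sdiff_subset, fun hsub => ?_⟩
            have := hsub (mem_inter.1 hx).1
            simp [hS, (mem_inter.1 hx).2] at this
          have := card_lt_card this
          have := hA E hE
          omega
        · simp only [mem_image, mem_filter, forall_exists_index, and_imp]
          rintro _ E hE - rfl
          obtain ⟨x, hx⟩ := hAB E₀ hE₀ E hE
          have : E \ S ⊂ E := by
            refine ⟨sdiff_subset, fun hsub => ?_⟩
            have := hsub (mem_inter.1 hx).2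
            simp [hS, (mem_inter.1 hx).1] at this
          have := card_lt_card this
          have := hB E hE
          omega
        · simp only [mem_image, mem_filter, forall_exists_index, and_imp]
          rintro _ E hE h1 rfl _ E' hE' h2 rfl
          obtain ⟨x, hx⟩ := hAB E hE E' hE'
          rw [mem_inter] at hx
          have hxS : x ∉ S := fun hxS => by
            rw [← h1, ← h2] at hd
            exact disjoint_left.1 hd (mem_inter.2 ⟨hx.1, hxS⟩) (mem_inter.2 ⟨hx.2, hxS⟩)
          exact ⟨x, by simp [hx, hxS]⟩
      · exact ⟨∅, by simp, fun E _ E' _ _ _ h => absurd h hd⟩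
    choose J hJ hJ' using key
    refine ⟨S ∪ (S.powerset ×ˢ S.powerset).biUnion J, ?_, fun E hE E' hE' => ?_⟩
    · refine (card_union_le _ _).trans (add_le_add hScard ?_)
      refine (card_biUnion_le_card_mul _ _ M fun p _ => hJ p).trans ?_
      rw [card_product, card_powerset]
      have := Nat.pow_le_pow_right (n := 2) (by norm_num) hScard
      gcongr
    · by_cases hd : Disjoint (E ∩ S) (E' ∩ S)
      · obtain ⟨x, hx⟩ := hJ' (E ∩ S, E' ∩ S) E hE E' hE' rfl rfl hd
        simp only [mem_inter] at hx
        refine ⟨x, mem_inter.2 ⟨mem_inter.2 hx.1, mem_union_right _ (mem_biUnion.2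
          ⟨(E ∩ S, E' ∩ S), ?_, hx.2⟩)⟩⟩
        simp [inter_subset_right]
      · obtain ⟨x, hx, hx'⟩ := not_disjoint_iff.1 hd
        simp only [mem_inter] at hx hx'
        exact ⟨x, by simp [hx, hx']⟩

/-- An intersecting family of `r`-sets has a kernel of bounded size. -/
theorem exists_kernel (r : ℕ) : ∃ M : ℕ, ∀ n F, IsIntersectingFamily n r F →
    ∃ J : Finset ℕ, #J ≤ M ∧ ∀ E ∈ F, ∀ E' ∈ F, (E ∩ E' ∩ J).Nonempty := by
  obtain ⟨M, hM⟩ := exists_cross_kernel r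
  refine ⟨M, fun n F hF => hM F F ?_ ?_ ?_⟩
  · exact fun E hE => (mem_powersetCard.1 (hF.1 hE)).2.le
  · exact fun E hE => (mem_powersetCard.1 (hF.1 hE)).2.le
  · intro E hE E' hE'
    exact not_disjoint_iff_nonempty_inter.1 (hF.2 hE hE')

/-! ### Degrees -/

theorem degree_mono {F G : Finset (Finset ℕ)} (h : F ⊆ G) (x : ℕ) : degree F x ≤ degree G x :=
  card_le_card (filter_subset_filter _ h)

theorem degree_le_maxDegree {n r : ℕ} {F : Finset (Finset ℕ)} (hF : F ⊆ powersetCard r (ground n))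
    (x : ℕ) : degree F x ≤ maxDegree n F := by
  by_cases hx : x ∈ ground n
  · exact le_sup (f := degree F) hx
  · have : degree F x = 0 := by
      rw [degree, card_eq_zero, filter_eq_empty_iff]
      exact fun E hE hxE => hx ((mem_powersetCard.1 (hF hE)).1 hxE)
    omega

theorem sum_card_inter_eq (F : Finset (Finset ℕ)) (W : Finset ℕ) :
    ∑ E ∈ F, #(E ∩ W) = ∑ x ∈ W, degree F x := by
  simp only [degree, card_filter]
  rw [sum_comm]
  refine sum_congr rfl fun E _ => ?_
  rw [← card_filter, inter_comm, filter_mem_eq_inter]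

theorem sum_card_inter_le {F : Finset (Finset ℕ)} {D : ℕ} (hD : ∀ x, degree F x ≤ D)
    (W : Finset ℕ) : ∑ E ∈ F, #(E ∩ W) ≤ #W * D := by
  rw [sum_card_inter_eq]
  exact (sum_le_card_nsmul _ _ D fun x _ => hD x).trans (by simp)

/-! ### Counting -/

theorem card_ground (n : ℕ) : #(ground n) = n := by simp [ground]

theorem binom_sub (m : ℕ) {r k : ℕ} (h : k ≤ r) : binom m ((r : ℤ) - k) = m.choose (r - k) := by
  rw [binom, if_pos (by omega)]
  congr 1
  omega

theorem card_trace_eq {n r : ℕ} {W A : Finset ℕ} (hW : W ⊆ ground n) (hA : A ⊆ W) :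
    #{E ∈ powersetCard r (ground n) | E ∩ W = A} = binom (n - #W) ((r : ℤ) - #A) := by
  by_cases h : #A ≤ r
  · have hc : n - #W = #(ground n \ W) := by rw [card_sdiff_of_subset hW, card_ground]
    rw [binom_sub _ h, hc, ← card_powersetCard]
    refine card_nbij' (· \ A) (· ∪ A) ?_ ?_ ?_ ?_
    · intro E hE
      rw [mem_coe, mem_filter, mem_powersetCard] at hE
      rw [mem_coe, mem_powersetCard]
      obtain ⟨⟨h1, h2⟩, h3⟩ := hE
      constructor
      · intro x hx
        rw [mem_sdiff] at hx ⊢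
        refine ⟨h1 hx.1, fun hxW => hx.2 ?_⟩
        rw [← h3]; exact mem_inter.2 ⟨hx.1, hxW⟩
      · rw [card_sdiff_of_subset, h2]
        rw [← h3]; exact inter_subset_left
    · intro E hE
      rw [mem_coe, mem_powersetCard] at hE
      rw [mem_coe, mem_filter, mem_powersetCard]
      obtain ⟨h1, h2⟩ := hE
      have hd : Disjoint E W := disjoint_left.2 fun x hx => (mem_sdiff.1 (h1 hx)).2
      refine ⟨⟨union_subset (h1.trans sdiff_subset) (hA.trans hW), ?_⟩, ?_⟩
      · rw [card_union_of_disjoint (disjoint_of_subset_right hA hd), h2]; omega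
      · rw [union_inter_distrib_right, disjoint_iff_inter_eq_empty.1 hd, empty_union,
          inter_eq_left.2 hA]
    · intro E hE
      rw [mem_coe, mem_filter] at hE
      refine sdiff_union_of_subset ?_
      rw [← hE.2]; exact inter_subset_left
    · intro E hE
      rw [mem_coe, mem_powersetCard] at hE
      refine union_sdiff_cancel_right (disjoint_left.2 fun x hx hxA => ?_)
      exact (mem_sdiff.1 (hE.1 hx)).2 (hA hxA)
  · rw [binom, if_neg (by omega), card_eq_zero, filter_eq_empty_iff]
    rintro E hE rfl
    refine h ((card_le_card inter_subset_left).trans ?_)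
    exact (mem_powersetCard.1 hE).2.le

theorem card_superset_le {n r : ℕ} {F : Finset (Finset ℕ)} (hF : F ⊆ powersetCard r (ground n))
    (A : Finset ℕ) : #{E ∈ F | A ⊆ E} ≤ binom (n - #A) ((r : ℤ) - #A) := by
  by_cases hA : A ⊆ ground n
  · rw [← card_trace_eq hA subset_rfl]
    refine card_le_card fun E hE => ?_
    rw [mem_filter] at hE ⊢
    exact ⟨hF hE.1, inter_eq_right.2 hE.2⟩
  · rw [filter_false_of_mem]
    · simp
    · exact fun E hE h => hA (h.trans (mem_powersetCard.1 (hF hE)).1)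

theorem card_trace_ge_four_le {n r : ℕ} {F : Finset (Finset ℕ)}
    (hF : F ⊆ powersetCard r (ground n)) (J : Finset ℕ) :
    #{E ∈ F | 4 ≤ #(E ∩ J)} ≤ (#J).choose 4 * binom (n - 4) ((r : ℤ) - 4) := by
  have hsub : {E ∈ F | 4 ≤ #(E ∩ J)} ⊆ (powersetCard 4 J).biUnion fun A => {E ∈ F | A ⊆ E} := by
    intro E hE
    rw [mem_filter] at hE
    obtain ⟨A, hA, hA4⟩ := exists_subset_card_eq hE.2
    rw [subset_inter_iff] at hA
    exact mem_biUnion.2 ⟨A, mem_powersetCard.2 ⟨hA.2, hA4⟩, mem_filter.2 ⟨hE.1, hA.1⟩⟩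
  refine (card_le_card hsub).trans ?_
  refine (card_biUnion_le_card_mul _ _ (binom (n - 4) ((r : ℤ) - 4)) fun A hA => ?_).trans ?_
  · have := card_superset_le hF A
    rwa [(mem_powersetCard.1 hA).2] at this
  · rw [card_powersetCard]

/-- The two binomials have orders n^s and n^(s+1). The hypothesis `h1` makes every factor of the
falling factorial on the right at least n/2. -/
theorem mul_choose_le_choose (s K n : ℕ) (h1 : 2 * (s + 7) ≤ n)
    (h2 : K * (2 ^ (s + 1) * (s + 1).factorial) ≤ n) :
    K * (n - 4).choose s ≤ (n - 7).choose (s + 1) := by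
  have ha : (n - 4).choose s ≤ n ^ s :=
    (Nat.choose_le_pow _ _).trans (Nat.pow_le_pow_left (by omega) _)
  have hb : n ^ (s + 1) ≤ 2 ^ (s + 1) * ((s + 1).factorial * (n - 7).choose (s + 1)) := by
    rw [← Nat.descFactorial_eq_factorial_mul_choose]
    calc n ^ (s + 1) ≤ (2 * (n - 7 + 1 - (s + 1))) ^ (s + 1) :=
          Nat.pow_le_pow_left (by omega) _
      _ = 2 ^ (s + 1) * (n - 7 + 1 - (s + 1)) ^ (s + 1) := mul_pow _ _ _
      _ ≤ _ := Nat.mul_le_mul_left _ (Nat.pow_sub_le_descFactorial _ _)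
  have hpos : 0 < 2 ^ (s + 1) * (s + 1).factorial := by positivity
  refine Nat.le_of_mul_le_mul_left ?_ hpos
  calc 2 ^ (s + 1) * (s + 1).factorial * (K * (n - 4).choose s)
      = K * (2 ^ (s + 1) * (s + 1).factorial) * (n - 4).choose s := by ring
    _ ≤ n * n ^ s := Nat.mul_le_mul h2 ha
    _ = n ^ (s + 1) := by ring
    _ ≤ _ := hb
    _ = _ := by ring

/-- Four prescribed points leave r - 4 free ones, one power of n fewer than three prescribed points
do. -/
theorem eventually_small (r : ℕ) (hr : 3 ≤ r) (M : ℕ) (ε : ℝ) (hε : 0 < ε) :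
    ∃ n₀ : ℕ, ∀ n ≥ n₀, r + 10 ≤ n ∧ 0 < binom (n - 7) ((r : ℤ) - 3) ∧
      (binom (n - 3) ((r : ℤ) - 3) : ℝ) ≤ (1 + ε) * binom (n - 7) ((r : ℤ) - 3) ∧
      ∀ F ⊆ powersetCard r (ground n), ∀ J : Finset ℕ, #J ≤ M →
        (#{E ∈ F | 4 ≤ #(E ∩ J)} : ℝ) ≤ ε * binom (n - 7) ((r : ℤ) - 3) := by
  -- The 4 pays for the four Pascal steps from n - 7 to n - 3, and `M.choose 4` for the 4-subsets of
  -- J.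
  obtain ⟨k, hk⟩ := exists_nat_gt ((4 + M.choose 4) / ε)
  rw [div_lt_iff₀ hε] at hk
  refine ⟨2 * (r + 10) + k * (2 ^ (r - 4 + 1) * (r - 4 + 1).factorial), fun n hn => ?_⟩
  have hb : ∀ m, binom m ((r : ℤ) - 3) = m.choose (r - 3) := fun m => binom_sub m hr
  have hn' : r + 10 ≤ n := by omega
  have hpos : 0 < (n - 7).choose (r - 3) := Nat.choose_pos (by omega)
  simp only [hb]
  refine ⟨hn', hpos, ?_⟩
  rcases hr.eq_or_lt with rfl | hr4
  · refine ⟨by simp; linarith, fun F hF J _ => ?_⟩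
    have := card_trace_ge_four_le hF J
    have h0 : binom (n - 4) (((3 : ℕ) : ℤ) - 4) = 0 := by simp [binom]
    rw [h0, mul_zero, Nat.le_zero] at this
    rw [this]
    simp [hε.le]
  · obtain ⟨s, rfl⟩ : ∃ s, r = s + 4 := ⟨r - 4, by omega⟩
    simp only [Nat.add_sub_cancel] at hn
    have h3 : s + 4 - 3 = s + 1 := by omega
    have hmain := mul_choose_le_choose s k n (by omega) (by omega)
    rw [h3]
    have hmain' : (k : ℝ) * (n - 4).choose s ≤ (n - 7).choose (s + 1) := by exact_mod_cast hmain
    have hbig : (4 + M.choose 4 : ℝ) * (n - 4).choose s ≤ ε * (n - 7).choose (s + 1) := by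
      calc (4 + M.choose 4 : ℝ) * (n - 4).choose s ≤ (k * ε) * (n - 4).choose s := by gcongr
        _ = ε * (k * (n - 4).choose s) := by ring
        _ ≤ _ := by gcongr
    constructor
    · obtain ⟨m, rfl⟩ : ∃ m, n = m + 7 := ⟨n - 7, by omega⟩
      have e : (m + 4).choose (s + 1) ≤ m.choose (s + 1) + 4 * (m + 3).choose s := by
        have f0 : (m + 1).choose (s + 1) = m.choose s + m.choose (s + 1) :=
          Nat.choose_succ_succ' m s
        have f1 : (m + 2).choose (s + 1) = (m + 1).choose s + (m + 1).choose (s + 1) :=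
          Nat.choose_succ_succ' (m + 1) s
        have f2 : (m + 3).choose (s + 1) = (m + 2).choose s + (m + 2).choose (s + 1) :=
          Nat.choose_succ_succ' (m + 2) s
        have f3 : (m + 4).choose (s + 1) = (m + 3).choose s + (m + 3).choose (s + 1) :=
          Nat.choose_succ_succ' (m + 3) s
        have g0 := Nat.choose_le_choose s (show m ≤ m + 3 by omega)
        have g1 := Nat.choose_le_choose s (show m + 1 ≤ m + 3 by omega)
        have g2 := Nat.choose_le_choose s (show m + 2 ≤ m + 3 by omega)
        omega
      have e' : ((m + 4).choose (s + 1) : ℝ) ≤ m.choose (s + 1) + 4 * (m + 3).choose s := by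
        exact_mod_cast e
      have i1 : m + 7 - 3 = m + 4 := by omega
      have i2 : m + 7 - 4 = m + 3 := by omega
      have i3 : m + 7 - 7 = m := by omega
      rw [i2, i3] at hbig
      rw [i1, i3]
      have : (0 : ℝ) ≤ (M.choose 4 : ℝ) * (m + 3).choose s := by positivity
      linarith
    · intro F hF J hJ
      have h := card_trace_ge_four_le hF J
      have hb4 : binom (n - 4) (((s + 4 : ℕ) : ℤ) - 4) = (n - 4).choose s := by
        have := binom_sub (n - 4) (show 4 ≤ s + 4 by omega)
        simpa using this
      rw [hb4] at h
      have h' : #{E ∈ F | 4 ≤ #(E ∩ J)} ≤ M.choose 4 * (n - 4).choose s :=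
        h.trans (Nat.mul_le_mul_right _ (Nat.choose_le_choose 4 hJ))
      have h'' : (#{E ∈ F | 4 ≤ #(E ∩ J)} : ℝ) ≤ M.choose 4 * (n - 4).choose s := by
        exact_mod_cast h'
      have : (0 : ℝ) ≤ ((n - 4).choose s : ℝ) := by positivity
      linarith

/-! ### Families with a cover of size two -/

/-- A family whose members of size at most two force every set meeting them to contain `z`. -/
def Rich (L : Finset (Finset ℕ)) (z : ℕ) : Prop :=
  {z} ∈ L ∨ 3 ≤ #{A ∈ L | #A = 2 ∧ z ∈ A}

/-- A family with a singleton or with at least five pairs. -/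
def Big (L : Finset (Finset ℕ)) : Prop :=
  (∃ z, {z} ∈ L) ∨ 5 ≤ #{A ∈ L | #A = 2}

/-- A set that avoids z must contain the other endpoint of each of three pairs through z, hence has
at least three points. -/
theorem Rich.mem {L : Finset (Finset ℕ)} {z : ℕ} (h : Rich L z) {B : Finset ℕ}
    (hB : ∀ A ∈ L, (A ∩ B).Nonempty) (hB2 : #B ≤ 2) : z ∈ B := by
  rcases h with h | h
  · obtain ⟨w, hw⟩ := hB _ h
    simp only [mem_inter, mem_singleton] at hw
    exact hw.1 ▸ hw.2
  · by_contra hz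
    have hsub : {A ∈ L | #A = 2 ∧ z ∈ A} ⊆ B.image fun c => {z, c} := by
      intro A hA
      rw [mem_filter] at hA
      obtain ⟨w, hw⟩ := hB _ hA.1
      rw [mem_inter] at hw
      refine mem_image.2 ⟨w, hw.2, eq_of_subset_of_card_le ?_ ?_⟩
      · simp [insert_subset_iff, hA.2.2, hw.1]
      · rw [hA.2.1, card_pair]
        rintro rfl
        exact hz hw.2
    have := (card_le_card hsub).trans card_image_le
    omega

theorem Big.rich_of_forall_mem {L : Finset (Finset ℕ)} {z : ℕ} (h : Big L)
    (hz : ∀ A ∈ L, #A ≤ 2 → z ∈ A) : Rich L z := by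
  rcases h with ⟨w, hw⟩ | h
  · have := hz _ hw (by simp)
    rw [mem_singleton] at this
    exact Or.inl (this ▸ hw)
  · refine Or.inr (le_trans (by omega) (h.trans (card_le_card fun A hA => ?_)))
    rw [mem_filter] at hA ⊢
    exact ⟨hA.1, hA.2, hz A hA.1 hA.2.le⟩

/-- Pigeonhole: five pairs met by two points put three of the pairs through one point. -/
theorem Big.exists_rich {L : Finset (Finset ℕ)} (h : Big L) {B : Finset ℕ}
    (hB : ∀ A ∈ L, (A ∩ B).Nonempty) (hB2 : #B ≤ 2) : ∃ z, Rich L z := by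
  rcases h with ⟨w, hw⟩ | h
  · exact ⟨w, Or.inl hw⟩
  · by_contra! hc
    have hsub : {A ∈ L | #A = 2} ⊆ B.biUnion fun c => {A ∈ L | #A = 2 ∧ c ∈ A} := by
      intro A hA
      rw [mem_filter] at hA
      obtain ⟨w, hw⟩ := hB _ hA.1
      rw [mem_inter] at hw
      exact mem_biUnion.2 ⟨w, hw.2, mem_filter.2 ⟨hA.1, hA.2, hw.1⟩⟩
    have := (card_le_card hsub).trans (card_biUnion_le_card_mul _ _ 2 fun c _ => by
      have := hc c
      rw [Rich] at this
      push Not at this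
      omega)
    omega

theorem Big.exists_small {L : Finset (Finset ℕ)} (h : Big L) : ∃ A ∈ L, #A ≤ 2 := by
  rcases h with ⟨w, hw⟩ | h
  · exact ⟨_, hw, by simp⟩
  · obtain ⟨A, hA⟩ := card_pos.1 (lt_of_lt_of_le (by norm_num) h)
    rw [mem_filter] at hA
    exact ⟨A, hA.1, hA.2.le⟩

/-- A small member of `L'` makes `L` rich at some z. Then all small members of `L'` contain z, so
`L'` is rich at z too, and this forces z back into the small members of `L`. -/
theorem Big.exists_common {L L' : Finset (Finset ℕ)} (h : Big L) (h' : Big L')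
    (hLL : ∀ A ∈ L, ∀ B ∈ L', (A ∩ B).Nonempty) :
    ∃ z, (∀ A ∈ L, #A ≤ 2 → z ∈ A) ∧ ∀ A ∈ L', #A ≤ 2 → z ∈ A := by
  obtain ⟨B, hB, hB2⟩ := h'.exists_small
  obtain ⟨z, hz⟩ := h.exists_rich (fun A hA => hLL A hA B hB) hB2
  have h2 : ∀ A ∈ L', #A ≤ 2 → z ∈ A := fun A hA hA2 => hz.mem (fun C hC => hLL C hC A hA) hA2
  have hz' := h'.rich_of_forall_mem h2
  exact ⟨z, fun A hA hA2 => hz'.mem (fun C hC => by rw [inter_comm]; exact hLL A hA C hC) hA2, h2⟩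

/-- Without singletons in the link, each member has a pair as its link or meets J in four points;
four pairs account for at most 4N members. -/
theorem big_link {G : Finset (Finset ℕ)} {J : Finset ℕ} {x y N : ℕ} (hx : x ∈ J)
    (hG : ∀ E ∈ G, x ∈ E ∧ y ∉ E) (hne : ∀ E ∈ G, ((E ∩ J) \ {x, y}).Nonempty)
    (hN : ∀ A : Finset ℕ, #A = 3 → #{E ∈ G | A ⊆ E} ≤ N)
    (hlarge : 4 * N + #{E ∈ G | 4 ≤ #(E ∩ J)} < #G) :
    Big (G.image fun E => (E ∩ J) \ {x, y}) := by
  set L := G.image fun E => (E ∩ J) \ {x, y} with hL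
  by_cases h1 : ∃ z, {z} ∈ L
  · exact Or.inl h1
  refine Or.inr ?_
  have hsub : G ⊆ ({A ∈ L | #A = 2}.biUnion fun A => {E ∈ G | insert x A ⊆ E}) ∪
      {E ∈ G | 4 ≤ #(E ∩ J)} := by
    intro E hE
    rw [mem_union]
    have hxE := (hG E hE).1
    have hyE := (hG E hE).2
    have hlk : (E ∩ J) \ {x, y} = (E ∩ J).erase x := by
      ext w
      simp only [mem_sdiff, mem_inter, mem_insert, mem_singleton, mem_erase]
      constructor
      · tauto
      · rintro ⟨h, h', h''⟩
        refine ⟨⟨h', h''⟩, ?_⟩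
        rintro (rfl | rfl)
        · exact h rfl
        · exact hyE h'
    have hmem : (E ∩ J) \ {x, y} ∈ L := mem_image_of_mem _ hE
    have hcard : #((E ∩ J) \ {x, y}) + 1 = #(E ∩ J) := by
      rw [hlk]
      exact card_erase_add_one (mem_inter.2 ⟨hxE, hx⟩)
    have hpos := card_pos.2 (hne E hE)
    have hne1 : #((E ∩ J) \ {x, y}) ≠ 1 := fun h => by
      obtain ⟨z, hz⟩ := card_eq_one.1 h
      exact h1 ⟨z, hz ▸ hmem⟩
    by_cases h2 : #((E ∩ J) \ {x, y}) = 2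
    · refine Or.inl (mem_biUnion.2 ⟨_, mem_filter.2 ⟨hmem, h2⟩, mem_filter.2 ⟨hE, ?_⟩⟩)
      exact insert_subset hxE (sdiff_subset.trans inter_subset_left)
    · exact Or.inr (mem_filter.2 ⟨hE, by omega⟩)
  have hb : #({A ∈ L | #A = 2}.biUnion fun A => {E ∈ G | insert x A ⊆ E}) ≤
      #{A ∈ L | #A = 2} * N := by
    refine card_biUnion_le_card_mul _ _ N fun A hA => hN _ ?_
    rw [mem_filter] at hA
    rw [card_insert_of_notMem, hA.2]
    obtain ⟨E, -, rfl⟩ := mem_image.1 hA.1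
    simp
  have htot := (card_le_card hsub).trans (card_union_le _ _)
  by_contra hlt
  have : #{A ∈ L | #A = 2} * N ≤ 4 * N := Nat.mul_le_mul_right _ (by omega)
  omega

/-- Compare the members containing only x with those containing only y. If one class is small, the
degrees of x and y suffice. Otherwise both links are big and cross-intersecting, hence share a point
z, and nearly every member meets {x, y, z} twice. -/
theorem two_cover_bound {F : Finset (Finset ℕ)} {J : Finset ℕ} {x y N D : ℕ} (hx : x ∈ J)
    (hy : y ∈ J) (hker : ∀ E ∈ F, ∀ E' ∈ F, (E ∩ E' ∩ J).Nonempty)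
    (hcov : ∀ E ∈ F, x ∈ E ∨ y ∈ E) (hN : ∀ A : Finset ℕ, #A = 3 → #{E ∈ F | A ⊆ E} ≤ N)
    (hD : ∀ x, degree F x ≤ D) :
    2 * #F ≤ 3 * D + 4 * N + 2 * #{E ∈ F | 4 ≤ #(E ∩ J)} ∧ #F ≤ 2 * D := by
  set q := #{E ∈ F | 4 ≤ #(E ∩ J)} with hq
  set Fx := {E ∈ F | x ∈ E ∧ y ∉ E} with hFx
  set Fy := {E ∈ F | y ∈ E ∧ x ∉ E} with hFy
  have hfx : #Fx + degree F y = #F := by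
    rw [hFx, degree, ← card_filter_add_card_filter_not (s := F) (fun E => y ∈ E), add_comm]
    congr 2
    refine filter_congr fun E hE => ?_
    have := hcov E hE
    tauto
  have hfy : #Fy + degree F x = #F := by
    rw [hFy, degree, ← card_filter_add_card_filter_not (s := F) (fun E => x ∈ E), add_comm]
    congr 2
    refine filter_congr fun E hE => ?_
    have := hcov E hE
    tauto
  have hxx : #Fx ≤ degree F x := by
    refine card_le_card fun E hE => ?_
    rw [hFx, mem_filter] at hE
    exact mem_filter.2 ⟨hE.1, hE.2.1⟩
  have hyy : #Fy ≤ degree F y := by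
    refine card_le_card fun E hE => ?_
    rw [hFy, mem_filter] at hE
    exact mem_filter.2 ⟨hE.1, hE.2.1⟩
  have hDx := hD x
  have hDy := hD y
  refine ⟨?_, by omega⟩
  by_cases hax : #Fx ≤ 4 * N + q
  · omega
  by_cases hay : #Fy ≤ 4 * N + q
  · omega
  have hcross : ∀ E ∈ Fx, ∀ E' ∈ Fy, (((E ∩ J) \ {x, y}) ∩ ((E' ∩ J) \ {x, y})).Nonempty := by
    intro E hE E' hE'
    rw [hFx, mem_filter] at hE
    rw [hFy, mem_filter] at hE'
    obtain ⟨w, hw⟩ := hker E hE.1 E' hE'.1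
    simp only [mem_inter] at hw
    refine ⟨w, ?_⟩
    simp only [mem_inter, mem_sdiff, mem_insert, mem_singleton, not_or, hw, true_and]
    have h1 : w ≠ x := fun h => hE'.2.2 (h ▸ hw.1.2)
    have h2 : w ≠ y := fun h => hE.2.2 (h ▸ hw.1.1)
    exact ⟨⟨h1, h2⟩, h1, h2⟩
  obtain ⟨Ex, hEx⟩ : Fx.Nonempty := card_pos.1 (by omega)
  obtain ⟨Ey, hEy⟩ : Fy.Nonempty := card_pos.1 (by omega)
  have hxF : Fx ⊆ F := filter_subset _ _
  have hyF : Fy ⊆ F := filter_subset _ _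
  have hqx : #{E ∈ Fx | 4 ≤ #(E ∩ J)} ≤ q := card_le_card (filter_subset_filter _ hxF)
  have hqy : #{E ∈ Fy | 4 ≤ #(E ∩ J)} ≤ q := card_le_card (filter_subset_filter _ hyF)
  have bigx : Big (Fx.image fun E => (E ∩ J) \ {x, y}) := by
    refine big_link (N := N) hx (fun E hE => (mem_filter.1 hE).2)
      (fun E hE => (hcross E hE Ey hEy).mono inter_subset_left) (fun A hA => ?_) (by omega)
    exact (card_le_card (filter_subset_filter _ hxF)).trans (hN A hA)
  have bigy : Big (Fy.image fun E => (E ∩ J) \ {x, y}) := by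
    have := big_link (G := Fy) (x := y) (y := x) (N := N) (J := J) hy (fun E hE => (mem_filter.1 hE).2)
      (fun E hE => ?_) (fun A hA => ?_) (by omega)
    · rwa [pair_comm] at this
    · rw [pair_comm]
      exact (hcross Ex hEx E hE).mono inter_subset_right
    · exact (card_le_card (filter_subset_filter _ hyF)).trans (hN A hA)
  obtain ⟨z, hzx, hzy⟩ := bigx.exists_common bigy (by
    simp only [mem_image, forall_exists_index, and_imp]
    rintro _ E hE rfl _ E' hE' rfl
    exact hcross E hE E' hE')
  have hz : z ≠ x ∧ z ≠ y := by
    obtain ⟨A, hA, hA2⟩ := bigx.exists_small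
    have := hzx A hA hA2
    obtain ⟨E, -, rfl⟩ := mem_image.1 hA
    simp only [mem_sdiff, mem_insert, mem_singleton] at this
    tauto
  have hxy : x ≠ y := by
    rintro rfl
    exact (mem_filter.1 hEx).2.2 (mem_filter.1 hEx).2.1
  have h2 : ∀ E ∈ F, ¬ 4 ≤ #(E ∩ J) → 2 ≤ #(E ∩ {x, y, z}) := by
    intro E hE hE4
    have hpair : ∀ {u v : ℕ}, u ∈ E → v ∈ E → u ≠ v → u ∈ ({x, y, z} : Finset ℕ) →
        v ∈ ({x, y, z} : Finset ℕ) → 2 ≤ #(E ∩ {x, y, z}) := by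
      intro u v hu hv huv hu' hv'
      rw [← card_pair huv]
      refine card_le_card ?_
      simp only [insert_subset_iff, mem_inter, singleton_subset_iff]
      exact ⟨⟨hu, hu'⟩, hv, hv'⟩
    have hlink : ∀ u ∈ E, u ∈ J → (u = x ∨ u = y) → #((E ∩ J) \ {x, y}) ≤ 2 := by
      intro u hu huJ hu'
      have : (E ∩ J) \ {x, y} ⊂ E ∩ J := by
        refine ⟨sdiff_subset, fun h => ?_⟩
        have := h (mem_inter.2 ⟨hu, huJ⟩)
        simp only [mem_sdiff, mem_insert, mem_singleton] at this
        tauto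
      have := card_lt_card this
      omega
    by_cases hxE : x ∈ E
    · by_cases hyE : y ∈ E
      · exact hpair hxE hyE hxy (by simp) (by simp)
      · have := hzx _ (mem_image_of_mem _ (mem_filter.2 ⟨hE, hxE, hyE⟩))
          (hlink x hxE hx (Or.inl rfl))
        exact hpair hxE (mem_inter.1 (mem_sdiff.1 this).1).1 hz.1.symm (by simp) (by simp)
    · have hyE := (hcov E hE).resolve_left hxE
      have := hzy _ (mem_image_of_mem _ (mem_filter.2 ⟨hE, hyE, hxE⟩))
        (hlink y hyE hy (Or.inr rfl))
      exact hpair hyE (mem_inter.1 (mem_sdiff.1 this).1).1 hz.2.symm (by simp) (by simp)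
  have hsum := sum_card_inter_le hD {x, y, z}
  have hcard : #({x, y, z} : Finset ℕ) ≤ 3 := card_le_three
  have hlow : 2 * #{E ∈ F | ¬ 4 ≤ #(E ∩ J)} ≤ ∑ E ∈ F, #(E ∩ {x, y, z}) := by
    rw [mul_comm, ← smul_eq_mul]
    refine (card_nsmul_le_sum _ _ 2 fun E hE => ?_).trans
      (sum_le_sum_of_subset (filter_subset (fun E => ¬ 4 ≤ #(E ∩ J)) F))
    rw [mem_filter] at hE
    exact h2 E hE.1 hE.2
  have hsplit := card_filter_add_card_filter_not (s := F) (fun E => 4 ≤ #(E ∩ J))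
  have := Nat.mul_le_mul_right D hcard
  omega

/-! ### Families whose traces on the kernel have size three -/

theorem card_le_card_traces_mul {F : Finset (Finset ℕ)} {J : Finset ℕ} {N : ℕ}
    (hN : ∀ A ∈ F.image (· ∩ J), #{E ∈ F | E ∩ J = A} ≤ N) : #F ≤ #(F.image (· ∩ J)) * N := by
  rw [mul_comm]
  exact card_le_mul_card_image F N hN

/-- Sum degrees over the most frequent trace, of multiplicity m. Its own members count three and all
others at least one, so |F| + 2m ≤ 3D; combine this with |F| ≤ 6m and m ≤ N. -/
theorem few_traces_bound {F : Finset (Finset ℕ)} {J : Finset ℕ} {N D : ℕ}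
    (hker : ∀ E ∈ F, ∀ E' ∈ F, (E ∩ E' ∩ J).Nonempty) (h3 : ∀ E ∈ F, #(E ∩ J) = 3)
    (hN : ∀ A ∈ F.image (· ∩ J), #{E ∈ F | E ∩ J = A} ≤ N)
    (hD : ∀ x, degree F x ≤ D) (h6 : #(F.image (· ∩ J)) ≤ 6) :
    2 * #F ≤ 3 * D + 4 * N ∧ 3 * #F ≤ 7 * D := by
  rcases F.eq_empty_or_nonempty with rfl | hne
  · simp
  obtain ⟨A, hA, hmax⟩ := exists_max_image (F.image (· ∩ J)) (fun A => #{E ∈ F | E ∩ J = A})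
    (hne.image _)
  obtain ⟨E₀, hE₀, rfl⟩ := mem_image.1 hA
  have hf := card_le_card_traces_mul (F := F) (J := J) hmax
  have hm := hN _ hA
  set m := #{E ∈ F | E ∩ J = E₀ ∩ J} with hmdef
  have hsum := sum_card_inter_le hD (E₀ ∩ J)
  rw [h3 E₀ hE₀] at hsum
  have hlow : #F + 2 * m ≤ ∑ E ∈ F, #(E ∩ (E₀ ∩ J)) := by
    have : #F + 2 * m = ∑ E ∈ F, (1 + if E ∩ J = E₀ ∩ J then 2 else 0) := by
      rw [sum_add_distrib, ← sum_filter, sum_const, sum_const, smul_eq_mul, smul_eq_mul]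
      ring
    rw [this]
    refine sum_le_sum fun E hE => ?_
    have hi : E ∩ (E₀ ∩ J) = E ∩ E₀ ∩ J := by rw [inter_assoc]
    split_ifs with h
    · have : E ∩ (E₀ ∩ J) = E₀ ∩ J := by
        rw [← h, ← inter_assoc, inter_self]
      rw [this, h3 E₀ hE₀]
    · rw [hi]
      exact card_pos.2 (hker E hE E₀ hE₀)
  have h6' : #(F.image (· ∩ J)) * m ≤ 6 * m := Nat.mul_le_mul_right _ h6
  constructor <;> omega

/-- A trace meeting Q in exactly two points is determined by that pair, so at most 6N members have
such traces; the others meet Q in three points. Degrees summed over Q then give 3|F| ≤ 4D + 6N and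
2|F| ≤ 4D. -/
theorem quad_bound {F : Finset (Finset ℕ)} {J Q : Finset ℕ} {N D : ℕ}
    (hker : ∀ E ∈ F, ∀ E' ∈ F, (E ∩ E' ∩ J).Nonempty) (h3 : ∀ E ∈ F, #(E ∩ J) = 3)
    (hN : ∀ A ∈ F.image (· ∩ J), #{E ∈ F | E ∩ J = A} ≤ N) (hD : ∀ x, degree F x ≤ D)
    (hcov : ∀ x y, ∃ E ∈ F, x ∉ E ∧ y ∉ E) (hQ : #Q = 4) (hFQ : ∀ E ∈ F, 2 ≤ #(E ∩ J ∩ Q)) :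
    2 * #F ≤ 3 * D + 3 * N ∧ #F ≤ 2 * D := by
  set F₂ := {E ∈ F | #(E ∩ J ∩ Q) = 2} with hF₂
  have hF₂F : F₂ ⊆ F := filter_subset _ _
  have hcard : #F₂ ≤ 6 * N := by
    refine (card_le_card_traces_mul (J := J) (N := N) fun A hA => ?_).trans
      (Nat.mul_le_mul_right _ ?_)
    · exact (card_le_card (filter_subset_filter _ hF₂F)).trans
        (hN A (image_subset_image hF₂F hA))
    · have h6 : #(powersetCard 2 Q) = 6 := by rw [card_powersetCard, hQ]; rfl
      rw [← h6]
      refine card_le_card_of_injOn (· ∩ Q) ?_ ?_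
      · intro A hA
        obtain ⟨E, hE, rfl⟩ := mem_image.1 (mem_coe.1 hA)
        exact mem_coe.2 (mem_powersetCard.2 ⟨inter_subset_right, (mem_filter.1 hE).2⟩)
      · intro A hA B hB hAB
        obtain ⟨E, hE, rfl⟩ := mem_image.1 (mem_coe.1 hA)
        obtain ⟨E', hE', rfl⟩ := mem_image.1 (mem_coe.1 hB)
        rw [hF₂, mem_filter] at hE hE'
        simp only at hAB
        obtain ⟨x, y, hxy, hP⟩ := card_eq_two.1 hE.2
        -- G takes the other two points of Q and a single point v outside Q, so a member with trace
        -- {x, y} on Q can meet G within J only at v.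
        obtain ⟨G, hG, hxG, hyG⟩ := hcov x y
        have hGQ : Disjoint (G ∩ J ∩ Q) {x, y} := by
          rw [disjoint_right]
          intro w hw hwG
          simp only [mem_inter, mem_insert, mem_singleton] at hw hwG
          rcases hw with rfl | rfl
          · exact hxG hwG.1.1
          · exact hyG hwG.1.1
        have hGsub : G ∩ J ∩ Q ⊆ Q \ {x, y} :=
          fun w hw => mem_sdiff.2 ⟨(mem_inter.1 hw).2, disjoint_left.1 hGQ hw⟩
        have hxyQ : {x, y} ⊆ Q := hP ▸ inter_subset_right
        have hQc : #(Q \ {x, y}) = 2 := by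
          rw [card_sdiff_of_subset hxyQ, hQ, card_pair hxy]
        have hGc : #(G ∩ J ∩ Q) = 2 :=
          le_antisymm (hQc ▸ card_le_card hGsub) (hFQ G hG)
        have hout : #((G ∩ J) \ Q) = 1 := by
          have := card_inter_add_card_sdiff (G ∩ J) Q
          have := h3 G hG
          omega
        obtain ⟨v, hv⟩ := card_eq_one.1 hout
        have key : ∀ H ∈ F, H ∩ J ∩ Q = {x, y} → H ∩ J = {x, y, v} := by
          intro H hH hHP
          obtain ⟨w, hw⟩ := hker H hH G hG
          simp only [mem_inter] at hw
          have hwQ : w ∉ Q := by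
            intro hwQ
            have h1 : w ∈ ({x, y} : Finset ℕ) := by
              rw [← hHP]; simp [hw, hwQ]
            exact disjoint_right.1 hGQ h1 (by simp [hw, hwQ])
          have hwv : w = v := by
            rw [← mem_singleton, ← hv]; simp [hw, hwQ]
          subst hwv
          symm
          have hxm : x ∈ H ∩ J ∩ Q := by rw [hHP]; simp
          have hym : y ∈ H ∩ J ∩ Q := by rw [hHP]; simp
          refine eq_of_subset_of_card_le ?_ ?_
          · simp only [insert_subset_iff, singleton_subset_iff]
            exact ⟨(mem_inter.1 hxm).1, (mem_inter.1 hym).1, by simp [hw]⟩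
          · rw [h3 H hH, card_eq_three.2 ⟨x, y, w, hxy, ?_, ?_, rfl⟩]
            · rintro rfl; exact hwQ (mem_inter.1 hxm).2
            · rintro rfl; exact hwQ (mem_inter.1 hym).2
        show E ∩ J = E' ∩ J
        rw [key E hE.1 hP, key E' hE'.1 (hAB ▸ hP)]
  have hsum := sum_card_inter_le hD Q
  rw [hQ] at hsum
  have hlow : 3 * #F ≤ ∑ E ∈ F, #(E ∩ Q) + #F₂ := by
    rw [hF₂, card_filter, ← sum_add_distrib, mul_comm, ← smul_eq_mul]
    refine card_nsmul_le_sum _ _ 3 fun E hE => ?_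
    have := hFQ E hE
    have : #(E ∩ J ∩ Q) ≤ #(E ∩ Q) :=
      card_le_card (inter_subset_inter_right inter_subset_left)
    split_ifs <;> omega
  have := card_le_card hF₂F
  have hlow' : 2 * #F ≤ ∑ E ∈ F, #(E ∩ Q) := by
    rw [mul_comm, ← smul_eq_mul]
    refine card_nsmul_le_sum _ _ 2 fun E hE => ?_
    exact (hFQ E hE).trans (card_le_card (inter_subset_inter_right inter_subset_left))
  constructor <;> omega

theorem six_points_bound {F : Finset (Finset ℕ)} {J W : Finset ℕ} {D : ℕ}
    (h3 : ∀ E ∈ F, #(E ∩ J) = 3) (hD : ∀ x, degree F x ≤ D) (hW : #W ≤ 6)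
    (hFW : ∀ E ∈ F, E ∩ J ⊆ W) : #F ≤ 2 * D := by
  have hsum := sum_card_inter_le hD W
  have hlow : 3 * #F ≤ ∑ E ∈ F, #(E ∩ W) := by
    rw [mul_comm, ← smul_eq_mul]
    refine card_nsmul_le_sum _ _ 3 fun E hE => ?_
    rw [← h3 E hE]
    exact card_le_card (subset_inter inter_subset_left (hFW E hE))
  have := Nat.mul_le_mul_right D hW
  omega

/-! ### Intersecting families of triples without a cover of size two -/

/-- The digits 1, ..., 5 stand for points a, ..., e, and `S13 u` says that the pair ac extends by
the outside point u. The `d` hypotheses say that disjoint pairs share their label. The `c`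
hypotheses say that a label of a pair recurs on a disjoint pair. -/
theorem no_two_labels {S34 S13 S14 S15 S23 S24 S25 : ℕ → Prop}
    (d1 : ∀ u v, S34 u → S15 v → u = v) (d2 : ∀ u v, S34 u → S25 v → u = v)
    (d3 : ∀ u v, S13 u → S24 v → u = v) (d4 : ∀ u v, S13 u → S25 v → u = v)
    (d5 : ∀ u v, S14 u → S23 v → u = v) (d6 : ∀ u v, S14 u → S25 v → u = v)
    (d7 : ∀ u v, S15 u → S23 v → u = v) (d8 : ∀ u v, S15 u → S24 v → u = v)
    (c13 : ∀ u, S13 u → S24 u ∨ S25 u) (c14 : ∀ u, S14 u → S23 u ∨ S25 u)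
    (c15 : ∀ u, S15 u → S34 u ∨ S23 u ∨ S24 u) (c25 : ∀ u, S25 u → S34 u ∨ S13 u ∨ S14 u)
    {x y z w : ℕ} (hx : S15 x) (hy : S34 y ∨ S14 y ∨ S24 y) (hz : S34 z ∨ S13 z ∨ S23 z)
    (hw : S34 w ∨ S13 w ∨ S14 w ∨ S15 w ∨ S23 w ∨ S24 w ∨ S25 w) : w = x := by
  by_contra hwx
  have hxw : ¬ x = w := fun h => hwx h.symm
  have n34 : ¬ S34 w := fun h => hwx (d1 w x h hx)
  have n23 : ¬ S23 w := fun h => hxw (d7 x w hx h)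
  have n24 : ¬ S24 w := fun h => hxw (d8 x w hx h)
  have n15 : ¬ S15 w := fun h => by have := c15 w h; tauto
  have h25 : S25 w := by have := c13 w; have := c14 w; tauto
  have m34 : ∀ u, ¬ S34 u := fun u h => hwx ((d2 u w h h25).symm.trans (d1 u x h hx))
  rcases (c25 w h25).resolve_left n34 with h | h
  · have m24 : ∀ u, ¬ S24 u := fun u hu => hwx ((d3 w u h hu).trans (d8 x u hx hu).symm)
    have h23 : S23 x := by have := c15 x hx; have := m34 x; have := m24 x; tauto
    have m14 : ¬ S14 y := fun hu => hwx ((d6 y w hu h25).symm.trans (d5 y x hu h23))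
    have := m34 y
    have := m24 y
    tauto
  · have m23 : ∀ u, ¬ S23 u := fun u hu => hwx ((d5 w u h hu).trans (d7 x u hx hu).symm)
    have h24 : S24 x := by have := c15 x hx; have := m34 x; have := m23 x; tauto
    have m13 : ¬ S13 z := fun hu => hwx ((d4 z w hu h25).symm.trans (d3 z x hu h24))
    have := m34 z
    have := m23 z
    tauto

/-- The labels by which the seven pairs of a five-point configuration are extended. -/
theorem labels_cases {S34 S13 S14 S15 S23 S24 S25 : ℕ → Prop}
    (d1 : ∀ u v, S34 u → S15 v → u = v) (d2 : ∀ u v, S34 u → S25 v → u = v)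
    (d3 : ∀ u v, S13 u → S24 v → u = v) (d4 : ∀ u v, S13 u → S25 v → u = v)
    (d5 : ∀ u v, S14 u → S23 v → u = v) (d6 : ∀ u v, S14 u → S25 v → u = v)
    (d7 : ∀ u v, S15 u → S23 v → u = v) (d8 : ∀ u v, S15 u → S24 v → u = v)
    (c13 : ∀ u, S13 u → S24 u ∨ S25 u) (c14 : ∀ u, S14 u → S23 u ∨ S25 u)
    (c15 : ∀ u, S15 u → S34 u ∨ S23 u ∨ S24 u)
    (c23 : ∀ u, S23 u → S14 u ∨ S15 u) (c24 : ∀ u, S24 u → S13 u ∨ S15 u)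
    (c25 : ∀ u, S25 u → S34 u ∨ S13 u ∨ S14 u) :
    (∃ w, ∀ u, S34 u ∨ S13 u ∨ S14 u ∨ S15 u ∨ S23 u ∨ S24 u ∨ S25 u → u = w) ∨
      (∀ u, ¬ S15 u ∧ ¬ S25 u) ∨ (∀ u, ¬ S34 u ∧ ¬ S14 u ∧ ¬ S24 u) ∨
      ∀ u, ¬ S34 u ∧ ¬ S13 u ∧ ¬ S23 u := by
  by_contra! h
  obtain ⟨h0, ⟨x, hx⟩, ⟨y, hy⟩, z, hz⟩ := h
  obtain ⟨w, hw, hwx⟩ := h0 x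
  refine hwx ?_
  have hy' : S34 y ∨ S14 y ∨ S24 y := by tauto
  have hz' : S34 z ∨ S13 z ∨ S23 z := by tauto
  by_cases h15 : S15 x
  · exact no_two_labels d1 d2 d3 d4 d5 d6 d7 d8 c13 c14 c15 c25 h15 hy' hz' hw
  -- The configuration is symmetric under exchanging 1 and 2, so a label on 25 is treated like one
  -- on 15.
  · have d : ∀ {P Q : ℕ → Prop}, (∀ u v, P u → Q v → u = v) → ∀ u v, Q u → P v → u = v :=
      fun h u v hu hv => (h v u hv hu).symm
    exact no_two_labels d2 d1 (d d5) (d d7) (d d3) (d d8) (d d4) (d d6) c23 c24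
      (fun u hu => c25 u hu) (fun u hu => c15 u hu) (hx h15) (y := y) (z := z)
      (by rcases hy' with h | h | h <;> simp only [h, true_or, or_true])
      (by rcases hz' with h | h | h <;> simp only [h, true_or, or_true])
      (by rcases hw with h | h | h | h | h | h | h <;> simp only [h, true_or, or_true])

theorem two_le_card_inter {E Q : Finset ℕ} {p q : ℕ} (hpq : p ≠ q) (hp : p ∈ E) (hq : q ∈ E)
    (hp' : p ∈ Q) (hq' : q ∈ Q) : 2 ≤ #(E ∩ Q) := by
  rw [← card_pair hpq]
  refine card_le_card ?_
  simp only [insert_subset_iff, mem_inter, singleton_subset_iff]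
  exact ⟨⟨hp, hp'⟩, hq, hq'⟩

theorem eq_triple {E : Finset ℕ} {p q u : ℕ} (hE : #E = 3) (hp : p ∈ E) (hq : q ∈ E) (hu : u ∈ E)
    (hpq : p ≠ q) (hpu : p ≠ u) (hqu : q ≠ u) : E = {p, q, u} := by
  symm
  refine eq_of_subset_of_card_le ?_ ?_
  · simp [insert_subset_iff, hp, hq, hu]
  · rw [hE, card_eq_three.2 ⟨p, q, u, hpq, hpu, hqu, rfl⟩]

theorem pair_of_meets {a b c d e : Prop} (h1 : a ∨ b ∨ c) (h2 : a ∨ b ∨ d) (h3 : c ∨ d ∨ e) :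
    (c ∧ d) ∨ (a ∧ c) ∨ (a ∧ d) ∨ (a ∧ e) ∨ (b ∧ c) ∨ (b ∧ d) ∨ (b ∧ e) := by tauto

theorem mem_of_meets_triple {E : Finset ℕ} {a b c : ℕ} (h : (E ∩ {a, b, c}).Nonempty) :
    a ∈ E ∨ b ∈ E ∨ c ∈ E := by
  obtain ⟨w, hw⟩ := h
  simp only [mem_inter, mem_insert, mem_singleton] at hw
  obtain ⟨h, rfl | rfl | rfl⟩ := hw
  exacts [Or.inl h, Or.inr (Or.inl h), Or.inr (Or.inr h)]

theorem third_eq_of_meets {E E' : Finset ℕ} {p q p' q' u v : ℕ} (hE : E = {p, q, u})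
    (hE' : E' = {p', q', v}) (h : (E ∩ E').Nonempty) (h1 : p ≠ p') (h2 : p ≠ q') (h3 : q ≠ p')
    (h4 : q ≠ q') (h5 : p ≠ v) (h6 : q ≠ v) (h7 : u ≠ p') (h8 : u ≠ q') : u = v := by
  obtain ⟨w, hw⟩ := h
  rw [hE, hE'] at hw
  simp only [mem_inter, mem_insert, mem_singleton] at hw
  obtain ⟨rfl | rfl | rfl, h | h | h⟩ := hw
  exacts [absurd h h1, absurd h h2, absurd h h5, absurd h h3, absurd h h4, absurd h h6,
    absurd h h7, absurd h h8, h]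

/-- Meeting abc, abd and cde forces one of seven pairs into each member. A single outside label w
leaves only the six points P ∪ {w}. In the other cases of `labels_cases` the pairs that still carry
labels lie in four points of P; triples inside P meet any such four points twice. -/
theorem six_points_or_quad_of_config {T : Finset (Finset ℕ)} (h3 : ∀ A ∈ T, #A = 3)
    (hi : ∀ A ∈ T, ∀ B ∈ T, (A ∩ B).Nonempty) (hcov : ∀ x y, ∃ A ∈ T, x ∉ A ∧ y ∉ A)
    {a b c d e : ℕ} (hab : a ≠ b) (hac : a ≠ c) (had : a ≠ d) (hae : a ≠ e) (hbc : b ≠ c)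
    (hbd : b ≠ d) (hbe : b ≠ e) (hcd : c ≠ d) (hce : c ≠ e) (hde : d ≠ e)
    (m1 : ∀ E ∈ T, a ∈ E ∨ b ∈ E ∨ c ∈ E) (m2 : ∀ E ∈ T, a ∈ E ∨ b ∈ E ∨ d ∈ E)
    (m3 : ∀ E ∈ T, c ∈ E ∨ d ∈ E ∨ e ∈ E) :
    (∃ W : Finset ℕ, #W ≤ 6 ∧ ∀ A ∈ T, A ⊆ W) ∨
      ∃ Q : Finset ℕ, #Q = 4 ∧ ∀ A ∈ T, 2 ≤ #(A ∩ Q) := by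
  have mem := fun E hE => pair_of_meets (m1 E hE) (m2 E hE) (m3 E hE)
  set P : Finset ℕ := {a, b, c, d, e} with hPdef
  let S : ℕ → ℕ → ℕ → Prop := fun p q u => u ∉ P ∧ ∃ E ∈ T, p ∈ E ∧ q ∈ E ∧ u ∈ E
  have pairs : ∀ E ∈ T, ∀ u ∈ E, u ∉ P → ∀ p q, p ∈ E → q ∈ E → S p q u :=
    fun E hE u hu huP p q hp hq => ⟨huP, E, hE, hp, hq, hu⟩
  have types : ∀ E ∈ T, ∀ u ∈ E, u ∉ P → S c d u ∨ S a c u ∨ S a d u ∨ S a e u ∨ S b c u ∨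
      S b d u ∨ S b e u := by
    intro E hE u hu huP
    rcases mem E hE with ⟨h, h'⟩ | ⟨h, h'⟩ | ⟨h, h'⟩ | ⟨h, h'⟩ | ⟨h, h'⟩ | ⟨h, h'⟩ | ⟨h, h'⟩ <;>
    simp only [pairs E hE u hu huP _ _ h h', true_or, or_true]
  have disj : ∀ p q p' q', p ∈ P → q ∈ P → p' ∈ P → q' ∈ P → p ≠ q → p' ≠ q' → p ≠ p' → p ≠ q' →
      q ≠ p' → q ≠ q' → ∀ u v, S p q u → S p' q' v → u = v := by
    rintro p q p' q' hp hq hp' hq' hpq hpq' h1 h2 h4 h5 u v ⟨hu, E, hE, hpE, hqE, huE⟩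
      ⟨hv, E', hE', hpE', hqE', hvE'⟩
    exact third_eq_of_meets
      (eq_triple (h3 E hE) hpE hqE huE hpq (fun h => hu (h ▸ hp)) (fun h => hu (h ▸ hq)))
      (eq_triple (h3 E' hE') hpE' hqE' hvE' hpq' (fun h => hv (h ▸ hp')) (fun h => hv (h ▸ hq')))
      (hi E hE E' hE') h1 h2 h4 h5 (fun h => hv (h ▸ hp)) (fun h => hv (h ▸ hq))
      (fun h => hu (h ▸ hp')) (fun h => hu (h ▸ hq'))
  -- As p and q are not a cover, some member avoids both; it must meet {p, q, u} at u. This yields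
  -- the recurrence of labels.
  have avoid : ∀ p q, p ∈ P → q ∈ P → p ≠ q → ∀ u, S p q u → ∃ E ∈ T, p ∉ E ∧ q ∉ E ∧
      ∀ p q, p ∈ E → q ∈ E → S p q u := by
    rintro p q hp hq hpq u ⟨hu, E, hE, hpE, hqE, huE⟩
    obtain ⟨E', hE', hpE', hqE'⟩ := hcov p q
    have i1 := eq_triple (h3 E hE) hpE hqE huE hpq (fun h => hu (h ▸ hp)) (fun h => hu (h ▸ hq))
    have i2 := mem_of_meets_triple (i1 ▸ hi E' hE' E hE)
    exact ⟨E', hE', hpE', hqE', pairs E' hE' u ((i2.resolve_left hpE').resolve_left hqE') hu⟩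
  have haP : a ∈ P := by simp [hPdef]
  have hbP : b ∈ P := by simp [hPdef]
  have hcP : c ∈ P := by simp [hPdef]
  have hdP : d ∈ P := by simp [hPdef]
  have heP : e ∈ P := by simp [hPdef]
  have hquad : ∀ Q : Finset ℕ, #Q = 4 → Q ⊆ P → (∀ E ∈ T, ∀ u ∈ E, u ∉ P → 2 ≤ #(E ∩ Q)) →
      ∃ Q : Finset ℕ, #Q = 4 ∧ ∀ A ∈ T, 2 ≤ #(A ∩ Q) := by
    intro Q hQ hQP h
    refine ⟨Q, hQ, fun E hE => ?_⟩
    by_cases hEP : E ⊆ P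
    · have h5 : #P ≤ 5 := card_le_five
      have h6 := card_union_add_card_inter E Q
      have h7 := card_le_card (union_subset hEP hQP)
      have h8 := h3 E hE
      omega
    · obtain ⟨u, hu, huP⟩ := not_subset.1 hEP
      exact h E hE u hu huP
  have cases := labels_cases (S34 := S c d) (S13 := S a c) (S14 := S a d) (S15 := S a e)
    (S23 := S b c) (S24 := S b d) (S25 := S b e)
    (disj c d a e hcP hdP haP heP hcd hae hac.symm hce had.symm hde)
    (disj c d b e hcP hdP hbP heP hcd hbe hbc.symm hce hbd.symm hde)
    (disj a c b d haP hcP hbP hdP hac hbd hab had hbc.symm hcd)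
    (disj a c b e haP hcP hbP heP hac hbe hab hae hbc.symm hce)
    (disj a d b c haP hdP hbP hcP had hbc hab hac hbd.symm hcd.symm)
    (disj a d b e haP hdP hbP heP had hbe hab hae hbd.symm hde)
    (disj a e b c haP heP hbP hcP hae hbc hab hac hbe.symm hce.symm)
    (disj a e b d haP heP hbP hdP hae hbd hab had hbe.symm hde.symm)
  have result := cases ?_ ?_ ?_ ?_ ?_ ?_
  · rcases result with ⟨w, hw⟩ | h | h | h
    · refine Or.inl ⟨insert w P, (card_insert_le _ _).trans (Nat.succ_le_succ card_le_five), ?_⟩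
      intro E hE u hu
      by_cases huP : u ∈ P
      · exact mem_insert_of_mem huP
      · rw [hw u (types E hE u hu huP)]
        exact mem_insert_self _ _
    · refine Or.inr (hquad {a, b, c, d} ?_ ?_ fun E hE u hu huP => ?_)
      · exact card_eq_four.2 ⟨a, b, c, d, hab, hac, had, hbc, hbd, hcd, rfl⟩
      · simp [insert_subset_iff, haP, hbP, hcP, hdP]
      · have s := pairs E hE u hu huP
        rcases mem E hE with ⟨h1, h2⟩ | ⟨h1, h2⟩ | ⟨h1, h2⟩ | ⟨h1, h2⟩ | ⟨h1, h2⟩ | ⟨h1, h2⟩ | ⟨h1, h2⟩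
        · exact two_le_card_inter hcd h1 h2 (by simp) (by simp)
        · exact two_le_card_inter hac h1 h2 (by simp) (by simp)
        · exact two_le_card_inter had h1 h2 (by simp) (by simp)
        · exact absurd (s _ _ h1 h2) (h u).1
        · exact two_le_card_inter hbc h1 h2 (by simp) (by simp)
        · exact two_le_card_inter hbd h1 h2 (by simp) (by simp)
        · exact absurd (s _ _ h1 h2) (h u).2
    · refine Or.inr (hquad {a, b, c, e} ?_ ?_ fun E hE u hu huP => ?_)
      · exact card_eq_four.2 ⟨a, b, c, e, hab, hac, hae, hbc, hbe, hce, rfl⟩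
      · simp [insert_subset_iff, haP, hbP, hcP, heP]
      · have s := pairs E hE u hu huP
        rcases mem E hE with ⟨h1, h2⟩ | ⟨h1, h2⟩ | ⟨h1, h2⟩ | ⟨h1, h2⟩ | ⟨h1, h2⟩ | ⟨h1, h2⟩ | ⟨h1, h2⟩
        · exact absurd (s _ _ h1 h2) (h u).1
        · exact two_le_card_inter hac h1 h2 (by simp) (by simp)
        · exact absurd (s _ _ h1 h2) (h u).2.1
        · exact two_le_card_inter hae h1 h2 (by simp) (by simp)
        · exact two_le_card_inter hbc h1 h2 (by simp) (by simp)
        · exact absurd (s _ _ h1 h2) (h u).2.2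
        · exact two_le_card_inter hbe h1 h2 (by simp) (by simp)
    · refine Or.inr (hquad {a, b, d, e} ?_ ?_ fun E hE u hu huP => ?_)
      · exact card_eq_four.2 ⟨a, b, d, e, hab, had, hae, hbd, hbe, hde, rfl⟩
      · simp [insert_subset_iff, haP, hbP, hdP, heP]
      · have s := pairs E hE u hu huP
        rcases mem E hE with ⟨h1, h2⟩ | ⟨h1, h2⟩ | ⟨h1, h2⟩ | ⟨h1, h2⟩ | ⟨h1, h2⟩ | ⟨h1, h2⟩ | ⟨h1, h2⟩
        · exact absurd (s _ _ h1 h2) (h u).1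
        · exact absurd (s _ _ h1 h2) (h u).2.1
        · exact two_le_card_inter had h1 h2 (by simp) (by simp)
        · exact two_le_card_inter hae h1 h2 (by simp) (by simp)
        · exact absurd (s _ _ h1 h2) (h u).2.2
        · exact two_le_card_inter hbd h1 h2 (by simp) (by simp)
        · exact two_le_card_inter hbe h1 h2 (by simp) (by simp)
  all_goals
    intro u hS
    obtain ⟨E, hE, n1, n2, s⟩ := avoid _ _ (by assumption) (by assumption) (by assumption) u hS
    rcases mem E hE with ⟨h1, h2⟩ | ⟨h1, h2⟩ | ⟨h1, h2⟩ | ⟨h1, h2⟩ | ⟨h1, h2⟩ | ⟨h1, h2⟩ | ⟨h1, h2⟩ <;>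
    first
    | exact absurd h1 n1
    | exact absurd h1 n2
    | exact absurd h2 n1
    | exact absurd h2 n2
    | simp only [s _ _ h1 h2, true_or, or_true]

/-- Two members abc and abd sharing a pair, together with a member avoiding a and b (necessarily
cde), supply the five-point configuration. -/
theorem six_points_or_quad {T : Finset (Finset ℕ)} (h3 : ∀ A ∈ T, #A = 3)
    (hi : ∀ A ∈ T, ∀ B ∈ T, (A ∩ B).Nonempty) (hcov : ∀ x y, ∃ A ∈ T, x ∉ A ∧ y ∉ A)
    (hnl : ∃ A ∈ T, ∃ B ∈ T, A ≠ B ∧ ∃ a b, a ≠ b ∧ a ∈ A ∧ a ∈ B ∧ b ∈ A ∧ b ∈ B) :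
    (∃ W : Finset ℕ, #W ≤ 6 ∧ ∀ A ∈ T, A ⊆ W) ∨
      ∃ Q : Finset ℕ, #Q = 4 ∧ ∀ A ∈ T, 2 ≤ #(A ∩ Q) := by
  obtain ⟨A, hA, B, hB, hAB, a, b, hab, haA, haB, hbA, hbB⟩ := hnl
  obtain ⟨c, hcA, hcB⟩ : ∃ c ∈ A, c ∉ B := by
    by_contra! h
    exact hAB (eq_of_subset_of_card_le h (by rw [h3 A hA, h3 B hB]))
  obtain ⟨d, hdB, hdA⟩ : ∃ d ∈ B, d ∉ A := by
    by_contra! h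
    exact hAB (eq_of_subset_of_card_le h (by rw [h3 A hA, h3 B hB])).symm
  have hac : a ≠ c := fun h => hcB (h ▸ haB)
  have hbc : b ≠ c := fun h => hcB (h ▸ hbB)
  have had : a ≠ d := fun h => hdA (h ▸ haA)
  have hbd : b ≠ d := fun h => hdA (h ▸ hbA)
  have hcd : c ≠ d := fun h => hcB (h ▸ hdB)
  have eA := eq_triple (h3 A hA) haA hbA hcA hab hac hbc
  have eB := eq_triple (h3 B hB) haB hbB hdB hab had hbd
  have m1 : ∀ E ∈ T, a ∈ E ∨ b ∈ E ∨ c ∈ E := fun E hE =>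
    mem_of_meets_triple (eA ▸ hi E hE A hA)
  have m2 : ∀ E ∈ T, a ∈ E ∨ b ∈ E ∨ d ∈ E := fun E hE =>
    mem_of_meets_triple (eB ▸ hi E hE B hB)
  obtain ⟨G, hG, haG, hbG⟩ := hcov a b
  have hcG : c ∈ G := ((m1 G hG).resolve_left haG).resolve_left hbG
  have hdG : d ∈ G := ((m2 G hG).resolve_left haG).resolve_left hbG
  obtain ⟨e, he⟩ : (G \ {c, d}).Nonempty := by
    rw [← card_pos, card_sdiff_of_subset (by simp [insert_subset_iff, hcG, hdG]), h3 G hG,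
      card_pair hcd]
    norm_num
  simp only [mem_sdiff, mem_insert, mem_singleton, not_or] at he
  obtain ⟨heG, hec, hed⟩ := he
  have eG := eq_triple (h3 G hG) hcG hdG heG hcd (Ne.symm hec) (Ne.symm hed)
  exact six_points_or_quad_of_config h3 hi hcov hab hac had (fun h => haG (h ▸ heG)) hbc hbd
    (fun h => hbG (h ▸ heG)) hcd (Ne.symm hec) (Ne.symm hed) m1 m2
    fun E hE => mem_of_meets_triple (eG ▸ hi E hE G hG)

/-! ### Linear families of triples -/

section Linear

variable {T : Finset (Finset ℕ)}

/-- By linearity, the members through v meet a member G avoiding v in distinct points. -/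
theorem linear_degree_le (h3 : ∀ A ∈ T, #A = 3) (hi : ∀ A ∈ T, ∀ B ∈ T, (A ∩ B).Nonempty)
    (hcov : ∀ x y, ∃ A ∈ T, x ∉ A ∧ y ∉ A)
    (hl : ∀ A ∈ T, ∀ B ∈ T, A ≠ B → ∀ x y, x ∈ A → x ∈ B → y ∈ A → y ∈ B → x = y) (v : ℕ) :
    degree T v ≤ 3 := by
  obtain ⟨G, hG, hv, -⟩ := hcov v v
  rw [← h3 G hG, degree]
  have hsub : ∀ A ∈ {E ∈ T | v ∈ E}, ∃ w ∈ G, w ∈ A := by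
    intro A hA
    obtain ⟨w, hw⟩ := hi A (mem_filter.1 hA).1 G hG
    exact ⟨w, (mem_inter.1 hw).2, (mem_inter.1 hw).1⟩
  choose! f hf hfA using hsub
  refine card_le_card_of_injOn f (fun A hA => hf A hA) fun A hA B hB hAB => ?_
  rw [mem_coe] at hA hB
  have hA' := mem_filter.1 hA
  have hB' := mem_filter.1 hB
  by_contra hne
  have := hl A hA'.1 B hB'.1 hne v (f A) hA'.2 hB'.2 (hfA A hA) (hAB ▸ hfA B hB)
  exact hv (this ▸ hf A hA)

/-- In a linear intersecting family of at least seven triples, exactly three members pass through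
each point of a member. -/
theorem linear_lines_through (h3 : ∀ A ∈ T, #A = 3) (hi : ∀ A ∈ T, ∀ B ∈ T, (A ∩ B).Nonempty)
    (hcov : ∀ x y, ∃ A ∈ T, x ∉ A ∧ y ∉ A)
    (hl : ∀ A ∈ T, ∀ B ∈ T, A ≠ B → ∀ x y, x ∈ A → x ∈ B → y ∈ A → y ∈ B → x = y)
    (h7 : 7 ≤ #T) {A : Finset ℕ} (hA : A ∈ T) {v : ℕ} (hv : v ∈ A) :
    ∃ B ∈ T, ∃ C ∈ T, B ≠ C ∧ B ≠ A ∧ C ≠ A ∧ v ∈ B ∧ v ∈ C ∧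
      ∀ E ∈ T, v ∈ E → E = A ∨ E = B ∨ E = C := by
  have hsum := sum_card_inter_eq T A
  -- The three degrees along A add up to at least 9 and are each at most 3, so all equal 3.
  have hlow : #T + 2 ≤ ∑ E ∈ T, #(E ∩ A) := by
    rw [← add_sum_erase T _ hA, inter_self, h3 A hA]
    have : #(T.erase A) ≤ ∑ E ∈ T.erase A, #(E ∩ A) := by
      rw [card_eq_sum_ones]
      exact sum_le_sum fun E hE => card_pos.2 (hi E (mem_of_mem_erase hE) A hA)
    have := card_erase_add_one hA
    omega
  have hup : ∑ x ∈ A, degree T x ≤ degree T v + 6 := by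
    rw [← add_sum_erase A _ hv]
    have := sum_le_card_nsmul (A.erase v) (degree T) 3
      fun x _ => linear_degree_le h3 hi hcov hl x
    rw [card_erase_of_mem hv, h3 A hA] at this
    rw [smul_eq_mul] at this
    exact Nat.add_le_add_left this _
  have hdeg : degree T v = 3 := by
    have := linear_degree_le h3 hi hcov hl v
    omega
  have hAv : A ∈ {E ∈ T | v ∈ E} := mem_filter.2 ⟨hA, hv⟩
  have h2 : #({E ∈ T | v ∈ E}.erase A) = 2 := by
    rw [card_erase_of_mem hAv]
    change degree T v - 1 = 2
    omega
  obtain ⟨B, C, hBC, he⟩ := card_eq_two.1 h2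
  have hB : B ∈ {E ∈ T | v ∈ E}.erase A := by rw [he]; simp
  have hC : C ∈ {E ∈ T | v ∈ E}.erase A := by rw [he]; simp
  simp only [mem_erase, mem_filter] at hB hC
  refine ⟨B, hB.2.1, C, hC.2.1, hBC, hB.1, hC.1, hB.2.2, hC.2.2, fun E hE hvE => ?_⟩
  by_cases hEA : E = A
  · exact Or.inl hEA
  · have : E ∈ {E ∈ T | v ∈ E}.erase A := by simp [hEA, hE, hvE]
    rw [he] at this
    simpa using Or.inr this

theorem image_fano {v : ℕ → ℕ} : fano.image (fun L => L.image v) =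
    {{v 1, v 2, v 4}, {v 1, v 3, v 7}, {v 1, v 5, v 6}, {v 2, v 3, v 5}, {v 2, v 6, v 7},
      {v 3, v 4, v 6}, {v 4, v 5, v 7}} := by
  simp [fano, image_insert]

theorem exists_fano_labelling {v1 v2 v3 v4 v5 v6 v7 : ℕ} (n12 : v1 ≠ v2) (n13 : v1 ≠ v3)
    (n14 : v1 ≠ v4) (n15 : v1 ≠ v5) (n16 : v1 ≠ v6) (n17 : v1 ≠ v7) (n23 : v2 ≠ v3)
    (n24 : v2 ≠ v4) (n25 : v2 ≠ v5) (n26 : v2 ≠ v6) (n27 : v2 ≠ v7) (n34 : v3 ≠ v4)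
    (n35 : v3 ≠ v5) (n36 : v3 ≠ v6) (n37 : v3 ≠ v7) (n45 : v4 ≠ v5) (n46 : v4 ≠ v6)
    (n47 : v4 ≠ v7) (n56 : v5 ≠ v6) (n57 : v5 ≠ v7) (n67 : v6 ≠ v7) :
    ∃ v : ℕ → ℕ, Set.InjOn v (ground 7) ∧ fano.image (fun L => L.image v) =
      {{v1, v2, v4}, {v1, v3, v7}, {v1, v5, v6}, {v2, v3, v5}, {v2, v6, v7}, {v3, v4, v6},
        {v4, v5, v7}} := by
  refine ⟨fun i => if i = 1 then v1 else if i = 2 then v2 else if i = 3 then v3 else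
    if i = 4 then v4 else if i = 5 then v5 else if i = 6 then v6 else v7, ?_, ?_⟩
  · intro i hi j hj hij
    simp only [ground, coe_Icc, Set.mem_Icc] at hi hj
    obtain ⟨i1, i7⟩ := hi
    obtain ⟨j1, j7⟩ := hj
    interval_cases i <;> interval_cases j <;> simp_all
  · rw [image_fano]
    simp

theorem linear_eq_fano (h3 : ∀ A ∈ T, #A = 3) (hi : ∀ A ∈ T, ∀ B ∈ T, (A ∩ B).Nonempty)
    (hcov : ∀ x y, ∃ A ∈ T, x ∉ A ∧ y ∉ A)
    (hl : ∀ A ∈ T, ∀ B ∈ T, A ≠ B → ∀ x y, x ∈ A → x ∈ B → y ∈ A → y ∈ B → x = y)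
    (h7 : 7 ≤ #T) :
    ∃ v : ℕ → ℕ, Set.InjOn v (ground 7) ∧ fano.image (fun L => L.image v) = T := by
  obtain ⟨A, hA⟩ : T.Nonempty := card_pos.1 (by omega)
  obtain ⟨v1, v2, v4, n12, n14, n24, rfl⟩ := card_eq_three.1 (h3 A hA)
  have thr := fun v hv => linear_lines_through h3 hi hcov hl h7 hA (v := v) hv
  have hmeet : ∀ B ∈ T, ∀ C ∈ T, ∃ w ∈ B, w ∈ C := by
    intro B hB C hC
    obtain ⟨w, hw⟩ := hi B hB C hC
    exact ⟨w, (mem_inter.1 hw).1, (mem_inter.1 hw).2⟩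
  obtain ⟨B, hB, B', hB', hBB, hBA, hBA', hB1, hB1', hall1⟩ := thr v1 (by simp)
  obtain ⟨D, hD, D', hD', hDD, hDA, hDA', hD2, hD2', hall2⟩ := thr v2 (by simp)
  obtain ⟨G, hG, G', hG', hGG, hGA, hGA', hG4, hG4', hall4⟩ := thr v4 (by simp)
  have only : ∀ E ∈ T, E ≠ {v1, v2, v4} → ∀ x ∈ ({v1, v2, v4} : Finset ℕ), x ∈ E →
      ∀ y ∈ ({v1, v2, v4} : Finset ℕ), x ≠ y → y ∉ E :=
    fun E hE hEA x hx hxE y hy hxy hyE => hxy (hl E hE _ hA hEA x y hxE hx hyE hy)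
  have hB2 := only B hB hBA v1 (by simp) hB1 v2 (by simp) n12
  have hB4 := only B hB hBA v1 (by simp) hB1 v4 (by simp) n14
  have hB2' := only B' hB' hBA' v1 (by simp) hB1' v2 (by simp) n12
  have hB4' := only B' hB' hBA' v1 (by simp) hB1' v4 (by simp) n14
  have hD1 := only D hD hDA v2 (by simp) hD2 v1 (by simp) n12.symm
  have hD4 := only D hD hDA v2 (by simp) hD2 v4 (by simp) n24
  have hD1' := only D' hD' hDA' v2 (by simp) hD2' v1 (by simp) n12.symm
  have hD4' := only D' hD' hDA' v2 (by simp) hD2' v4 (by simp) n24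
  have hG1 := only G hG hGA v4 (by simp) hG4 v1 (by simp) n14.symm
  have hG1' := only G' hG' hGA' v4 (by simp) hG4' v1 (by simp) n14.symm
  obtain ⟨v3, h3D, h3B⟩ := hmeet D hD B hB
  obtain ⟨v5, h5D, h5B⟩ := hmeet D hD B' hB'
  obtain ⟨v7, h7D, h7B⟩ := hmeet D' hD' B hB
  obtain ⟨v6, h6D, h6B⟩ := hmeet D' hD' B' hB'
  have n13 : v1 ≠ v3 := fun h => hD1 (h ▸ h3D)
  have n15 : v1 ≠ v5 := fun h => hD1 (h ▸ h5D)
  have n16 : v1 ≠ v6 := fun h => hD1' (h ▸ h6D)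
  have n17 : v1 ≠ v7 := fun h => hD1' (h ▸ h7D)
  have n23 : v2 ≠ v3 := fun h => hB2 (h ▸ h3B)
  have n25 : v2 ≠ v5 := fun h => hB2' (h ▸ h5B)
  have n26 : v2 ≠ v6 := fun h => hB2' (h ▸ h6B)
  have n27 : v2 ≠ v7 := fun h => hB2 (h ▸ h7B)
  have n34 : v3 ≠ v4 := fun h => hB4 (h ▸ h3B)
  have n45 : v4 ≠ v5 := fun h => hB4' (h ▸ h5B)
  have n46 : v4 ≠ v6 := fun h => hB4' (h ▸ h6B)
  have n47 : v4 ≠ v7 := fun h => hB4 (h ▸ h7B)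
  have n35 : v3 ≠ v5 := fun h => n13 (hl B hB B' hB' hBB v1 v3 hB1 hB1' h3B (h ▸ h5B))
  have n36 : v3 ≠ v6 := fun h => n13 (hl B hB B' hB' hBB v1 v3 hB1 hB1' h3B (h ▸ h6B))
  have n57 : v5 ≠ v7 := fun h => n15 (hl B hB B' hB' hBB v1 v5 hB1 hB1' (h ▸ h7B) h5B)
  have n67 : v6 ≠ v7 := fun h => n16 (hl B hB B' hB' hBB v1 v6 hB1 hB1' (h ▸ h7B) h6B)
  have n37 : v3 ≠ v7 := fun h => n23 (hl D hD D' hD' hDD v2 v3 hD2 hD2' h3D (h ▸ h7D))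
  have n56 : v5 ≠ v6 := fun h => n25 (hl D hD D' hD' hDD v2 v5 hD2 hD2' h5D (h ▸ h6D))
  have eB := eq_triple (h3 B hB) hB1 h3B h7B n13 n17 n37
  have eB' := eq_triple (h3 B' hB') hB1' h5B h6B n15 n16 n56
  have eD := eq_triple (h3 D hD) hD2 h3D h5D n23 n25 n35
  have eD' := eq_triple (h3 D' hD') hD2' h6D h7D n26 n27 n67
  have key : ∀ G ∈ T, ∀ G' ∈ T, v1 ∉ G → v1 ∉ G' → v4 ∈ G → v4 ∈ G' → v3 ∈ G → v7 ∈ G' →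
      G = {v3, v4, v6} ∧ G' = {v4, v5, v7} := by
    intro G hG G' hG' hG1 hG1' hG4 hG4' hG3 hG7
    have m := mem_of_meets_triple (eB' ▸ hi G hG B' hB')
    have m' := mem_of_meets_triple (eB' ▸ hi G' hG' B' hB')
    have k5 : v5 ∉ G := fun h =>
      n35 (hl G hG D hD (fun e => hD4 (e ▸ hG4)) v3 v5 hG3 h3D h h5D)
    have k6 : v6 ∉ G' := fun h =>
      n67 (hl G' hG' D' hD' (fun e => hD4' (e ▸ hG4')) v6 v7 h h6D hG7 h7D)
    have l6 : v6 ∈ G := (m.resolve_left hG1).resolve_left k5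
    have l5 : v5 ∈ G' := (m'.resolve_left hG1').resolve_right k6
    exact ⟨eq_triple (h3 G hG) hG3 hG4 l6 n34 n36 n46,
      eq_triple (h3 G' hG') hG4' l5 hG7 n45 n47 n57⟩
  have k3 : ¬ (v3 ∈ G ∧ v3 ∈ G') := fun h =>
    n34 (hl G hG G' hG' hGG v3 v4 h.1 h.2 hG4 hG4')
  have k7 : ¬ (v7 ∈ G ∧ v7 ∈ G') := fun h =>
    n47 (hl G hG G' hG' hGG v4 v7 hG4 hG4' h.1 h.2)
  have hGs : ({v3, v4, v6} ∈ T ∧ {v4, v5, v7} ∈ T) ∧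
      ∀ E ∈ T, v4 ∈ E → E = {v1, v2, v4} ∨ E = {v3, v4, v6} ∨ E = {v4, v5, v7} := by
    have m := (mem_of_meets_triple (eB ▸ hi G hG B hB)).resolve_left hG1
    have m' := (mem_of_meets_triple (eB ▸ hi G' hG' B hB)).resolve_left hG1'
    rcases m with m | m
    · obtain ⟨e1, e2⟩ := key G hG G' hG' hG1 hG1' hG4 hG4' m
        (m'.resolve_left fun h => k3 ⟨m, h⟩)
      rw [e1, e2] at hall4
      exact ⟨⟨e1 ▸ hG, e2 ▸ hG'⟩, hall4⟩
    · obtain ⟨e1, e2⟩ := key G' hG' G hG hG1' hG1 hG4' hG4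
        (m'.resolve_right fun h => k7 ⟨m, h⟩) m
      rw [e1, e2] at hall4
      exact ⟨⟨e1 ▸ hG', e2 ▸ hG⟩, fun E hE h => (hall4 E hE h).imp_right Or.symm⟩
  obtain ⟨v, hv, hvT⟩ := exists_fano_labelling n12 n13 n14 n15 n16 n17 n23 n24 n25 n26 n27 n34 n35
    n36 n37 n45 n46 n47 n56 n57 n67
  refine ⟨v, hv, hvT.trans (Subset.antisymm ?_ ?_)⟩
  · simp only [insert_subset_iff, singleton_subset_iff]
    exact ⟨hA, eB ▸ hB, eB' ▸ hB', eD ▸ hD, eD' ▸ hD', hGs.1.1, hGs.1.2⟩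
  · intro E hE
    simp only [mem_insert, mem_singleton]
    rw [eB, eB'] at hall1
    rw [eD, eD'] at hall2
    rcases mem_of_meets_triple (hi E hE _ hA) with h | h | h
    · rcases hall1 E hE h with h | h | h <;> simp only [h, true_or, or_true]
    · rcases hall2 E hE h with h | h | h <;> simp only [h, true_or, or_true]
    · rcases hGs.2 E hE h with h | h | h <;> simp only [h, true_or, or_true]

end Linear

/-! ### Isomorphic families -/

theorem degree_image (σ : Equiv.Perm ℕ) (F : Finset (Finset ℕ)) (x : ℕ) :
    degree (F.image fun E => E.image σ) (σ x) = degree F x := by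
  rw [degree, degree, filter_image, card_image_of_injective _ (image_injective σ.injective)]
  congr 1
  refine filter_congr fun E _ => ?_
  simp

theorem Isomorphic.diversity_eq {n : ℕ} {F G : Finset (Finset ℕ)} (h : Isomorphic n F G) (C : ℝ) :
    diversity n C F = diversity n C G := by
  obtain ⟨σ, hσ, rfl⟩ := h
  have h1 : #(F.image fun E => E.image σ) = #F :=
    card_image_of_injective _ (image_injective σ.injective)
  have h2 : maxDegree n (F.image fun E => E.image σ) = maxDegree n F := by
    rw [maxDegree, ← hσ, sup_image, maxDegree]
    exact sup_congr rfl fun x _ => degree_image σ F x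
  rw [diversity, diversity, h1, h2]

theorem exists_perm_extending {n m : ℕ} (hmn : m ≤ n) {v : ℕ → ℕ} (hv : Set.InjOn v (ground m))
    (hvn : ∀ i ∈ ground m, v i ∈ ground n) :
    ∃ σ : Equiv.Perm ℕ, (ground n).image σ = ground n ∧ ∀ i ∈ ground m, σ i = v i := by
  have hsub : ground m ⊆ ground n := Icc_subset_Icc_right hmn
  obtain ⟨g, hg⟩ := exists_equiv_extend_of_card_eq (α := ground n) (t := ground n)
    (s := univ.filter fun x : ground n => (x : ℕ) ∈ ground m) (f := fun x => v x)
    (Fintype.card_coe _) (by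
      intro y hy
      obtain ⟨x, hx, rfl⟩ := mem_image.1 hy
      exact hvn _ (mem_filter.1 hx).2) (by
      intro x hx y hy hxy
      exact Subtype.ext (hv (mem_filter.1 (mem_coe.1 hx)).2 (mem_filter.1 (mem_coe.1 hy)).2 hxy))
  refine ⟨Equiv.Perm.ofSubtype (p := fun x => x ∈ ground n) g, ?_, fun i hi => ?_⟩
  · refine eq_of_subset_of_card_le ?_ ?_
    · intro y hy
      obtain ⟨x, hx, rfl⟩ := mem_image.1 hy
      rw [Equiv.Perm.ofSubtype_apply_of_mem (p := fun x => x ∈ ground n) g hx]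
      exact (g ⟨x, hx⟩).2
    · rw [card_image_of_injective _ (Equiv.injective _)]
  · rw [Equiv.Perm.ofSubtype_apply_of_mem (p := fun x => x ∈ ground n) g (hsub hi)]
    exact hg ⟨i, hsub hi⟩ (by simp [hi])

/-! ### The Fano plane -/

theorem card_of_mem_fano : ∀ A ∈ fano, #A = 3 := by decide +kernel

theorem card_fano : #fano = 7 := by decide +kernel

theorem fano_subset : fano ⊆ (ground 7).powerset := by decide +kernel

theorem degree_fano : ∀ x ∈ ground 7, #{A ∈ fano | x ∈ A} = 3 := by decide +kernel

theorem card_of_mem_fanoPlus_sdiff : ∀ A ∈ fanoPlus \ fano, #A = 4 := by decide +kernel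

theorem card_fanoPlus_sdiff : #(fanoPlus \ fano) = 28 := by decide +kernel

theorem fanoPlus_sdiff_subset : fanoPlus \ fano ⊆ (ground 7).powerset := by decide +kernel

theorem degree_fanoPlus_sdiff : ∀ x ∈ ground 7, #{A ∈ fanoPlus \ fano | x ∈ A} = 16 := by
  decide +kernel

theorem fano_blocking : ∀ S ∈ (ground 7).powerset, (∀ L ∈ fano, (S ∩ L).Nonempty) →
    S ∈ fano ∨ S ∈ fanoPlus \ fano ∨ 5 ≤ #S := by
  decide +kernel

theorem fano_subset_fanoPlus : fano ⊆ fanoPlus := subset_union_left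

/-! ### Trace families -/

theorem card_traceFamily {n r : ℕ} (hn : 7 ≤ n) {B : Finset (Finset ℕ)}
    (hB : B ⊆ (ground 7).powerset) :
    #(traceFamily n r B) = ∑ A ∈ B, binom (n - 7) ((r : ℤ) - #A) := by
  have hsub : ground 7 ⊆ ground n := Icc_subset_Icc_right hn
  refine (card_eq_sum_card_fiberwise (f := (· ∩ ground 7)) (s := traceFamily n r B) (t := B)
    (fun E hE => (mem_filter.1 (mem_coe.1 hE)).2)).trans (sum_congr rfl fun A hA => ?_)
  have := card_trace_eq (r := r) hsub (mem_powerset.1 (hB hA))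
  rw [card_ground] at this
  rw [← this, traceFamily, filter_filter]
  congr 1
  refine filter_congr fun E _ => ?_
  constructor
  · exact fun h => h.2
  · rintro rfl
    exact ⟨hA, rfl⟩

theorem card_traceFamily_const {n r k : ℕ} (hn : 7 ≤ n) {B : Finset (Finset ℕ)}
    (hB : B ⊆ (ground 7).powerset) (hk : ∀ A ∈ B, #A = k) :
    #(traceFamily n r B) = #B * binom (n - 7) ((r : ℤ) - k) := by
  rw [card_traceFamily hn hB, sum_congr rfl fun A hA => by rw [hk A hA], sum_const, smul_eq_mul]

theorem degree_traceFamily {n r x : ℕ} (hx : x ∈ ground 7) (B : Finset (Finset ℕ)) :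
    degree (traceFamily n r B) x = #(traceFamily n r {A ∈ B | x ∈ A}) := by
  rw [degree, traceFamily, traceFamily, filter_filter]
  congr 1
  refine filter_congr fun E _ => ?_
  simp [hx]

theorem traceFamily_union {n r : ℕ} (B B' : Finset (Finset ℕ)) :
    traceFamily n r (B ∪ B') = traceFamily n r B ∪ traceFamily n r B' := by
  simp only [traceFamily, mem_union, filter_or]

theorem card_traceFamily_union {n r : ℕ} {B B' : Finset (Finset ℕ)} (h : Disjoint B B') :
    #(traceFamily n r (B ∪ B')) = #(traceFamily n r B) + #(traceFamily n r B') := by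
  rw [traceFamily_union, card_union_of_disjoint]
  rw [disjoint_left]
  intro E hE hE'
  exact disjoint_left.1 h (mem_filter.1 hE).2 (mem_filter.1 hE').2

theorem fanoPlus_eq : fanoPlus = fano ∪ fanoPlus \ fano :=
  (union_sdiff_of_subset fano_subset_fanoPlus).symm

theorem card_fanoFamily {n r : ℕ} (hn : 7 ≤ n) :
    #(fanoFamily n r) = 7 * binom (n - 7) ((r : ℤ) - 3) := by
  rw [fanoFamily, card_traceFamily_const hn fano_subset card_of_mem_fano, card_fano]
  rfl

theorem card_fanoPlus_sdiff_family {n r : ℕ} (hn : 7 ≤ n) :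
    #(traceFamily n r (fanoPlus \ fano)) = 28 * binom (n - 7) ((r : ℤ) - 4) := by
  rw [card_traceFamily_const hn fanoPlus_sdiff_subset card_of_mem_fanoPlus_sdiff,
    card_fanoPlus_sdiff]
  rfl

theorem card_fanoPlusFamily {n r : ℕ} (hn : 7 ≤ n) :
    #(fanoPlusFamily n r) =
      7 * binom (n - 7) ((r : ℤ) - 3) + 28 * binom (n - 7) ((r : ℤ) - 4) := by
  rw [fanoPlusFamily, fanoPlus_eq, card_traceFamily_union disjoint_sdiff,
    ← card_fanoPlus_sdiff_family hn, ← card_fanoFamily hn, fanoFamily]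

theorem degree_fanoFamily {n r x : ℕ} (hn : 7 ≤ n) (hx : x ∈ ground 7) :
    degree (fanoFamily n r) x = 3 * binom (n - 7) ((r : ℤ) - 3) := by
  rw [fanoFamily, degree_traceFamily hx, card_traceFamily_const hn
    ((filter_subset _ _).trans fano_subset) fun A hA => card_of_mem_fano A (mem_filter.1 hA).1,
    degree_fano x hx]
  rfl

theorem degree_fanoPlusFamily {n r x : ℕ} (hn : 7 ≤ n) (hx : x ∈ ground 7) :
    degree (fanoPlusFamily n r) x =
      3 * binom (n - 7) ((r : ℤ) - 3) + 16 * binom (n - 7) ((r : ℤ) - 4) := by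
  rw [fanoPlusFamily, degree_traceFamily hx, fanoPlus_eq, filter_union,
    card_traceFamily_union (disjoint_filter_filter disjoint_sdiff), ← degree_traceFamily hx,
    ← fanoFamily, degree_fanoFamily hn hx, card_traceFamily_const hn
    ((filter_subset _ _).trans fanoPlus_sdiff_subset)
    fun A hA => card_of_mem_fanoPlus_sdiff A (mem_filter.1 hA).1, degree_fanoPlus_sdiff x hx]
  rfl

/-- The maximum degree of a trace family whose degree is constant on `[7]`, when few `r`-sets
meet a set of eight points in more than three points. -/
theorem maxDegree_traceFamily {n r d : ℕ} (hn : 7 ≤ n) {B : Finset (Finset ℕ)}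
    (hB : ∀ A ∈ B, 3 ≤ #A) (hd : ∀ x ∈ ground 7, degree (traceFamily n r B) x = d)
    (hsmall : ∀ J : Finset ℕ, #J ≤ 8 → #{E ∈ traceFamily n r B | 4 ≤ #(E ∩ J)} ≤ d) :
    maxDegree n (traceFamily n r B) = d := by
  refine le_antisymm (Finset.sup_le fun x _ => ?_) ?_
  · by_cases hx7 : x ∈ ground 7
    · exact (hd x hx7).le
    -- A member through a point x outside [7] has at least three points in [7], hence four in the
    -- eight-point set.
    · refine (card_le_card ?_).trans (hsmall (insert x (ground 7)) ?_)
      · intro E hE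
        obtain ⟨hE, hxE⟩ := mem_filter.1 hE
        refine mem_filter.2 ⟨hE, ?_⟩
        have h3 := hB _ (mem_filter.1 hE).2
        have hx' : x ∉ E ∩ ground 7 := fun h => hx7 (mem_inter.1 h).2
        rw [inter_insert_of_mem hxE, card_insert_of_notMem hx']
        omega
      · exact (card_insert_le _ _).trans (by rw [card_ground])
  · have h1 : 1 ∈ ground 7 := by decide
    rw [← hd 1 h1]
    exact le_sup (f := degree (traceFamily n r B)) (Icc_subset_Icc_right hn h1)

/-- The three-part count of a family all of whose members meet every line of the Fano plane. -/
theorem fano_count {n r D : ℕ} (hn : 7 ≤ n) {F : Finset (Finset ℕ)}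
    (hF : F ⊆ powersetCard r (ground n)) (hblock : ∀ E ∈ F, ∀ L ∈ fano, (E ∩ L).Nonempty)
    (hD : ∀ x, degree F x ≤ D) :
    ∃ a b c : ℕ, #F = a + b + c ∧ 3 * a + 4 * b + 5 * c ≤ 7 * D ∧
      a ≤ 7 * binom (n - 7) ((r : ℤ) - 3) ∧ b ≤ 28 * binom (n - 7) ((r : ℤ) - 4) ∧
      (a = 7 * binom (n - 7) ((r : ℤ) - 3) → b = 28 * binom (n - 7) ((r : ℤ) - 4) → c = 0 →
        F = fanoPlusFamily n r) ∧
      (a = 7 * binom (n - 7) ((r : ℤ) - 3) → b = 0 → c = 0 → F = fanoFamily n r) := by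
  set Fa := {E ∈ F | E ∩ ground 7 ∈ fano} with hFa
  set Fb := {E ∈ F | E ∩ ground 7 ∈ fanoPlus \ fano} with hFb
  set Fc := {E ∈ F | ¬ (E ∩ ground 7 ∈ fano) ∧ ¬ (E ∩ ground 7 ∈ fanoPlus \ fano)} with hFc
  have hsubA : Fa ⊆ fanoFamily n r := fun E hE =>
    mem_filter.2 ⟨hF (mem_filter.1 hE).1, (mem_filter.1 hE).2⟩
  have hsubB : Fb ⊆ traceFamily n r (fanoPlus \ fano) := fun E hE =>
    mem_filter.2 ⟨hF (mem_filter.1 hE).1, (mem_filter.1 hE).2⟩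
  have hdAB : Disjoint Fa Fb := by
    rw [disjoint_left]
    intro E hE hE'
    exact (mem_sdiff.1 (mem_filter.1 hE').2).2 (mem_filter.1 hE).2
  have hdC : Disjoint (Fa ∪ Fb) Fc := by
    rw [disjoint_left]
    intro E hE hE'
    rcases mem_union.1 hE with h | h
    · exact (mem_filter.1 hE').2.1 (mem_filter.1 h).2
    · exact (mem_filter.1 hE').2.2 (mem_filter.1 h).2
  have hunion : F = Fa ∪ Fb ∪ Fc := by
    ext E
    simp only [hFa, hFb, hFc, mem_union, mem_filter]
    tauto
  have hmem : ∀ E ∈ Fc, 5 ≤ #(E ∩ ground 7) := by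
    intro E hE
    obtain ⟨hE, h1, h2⟩ := mem_filter.1 hE
    refine ((fano_blocking (E ∩ ground 7) (mem_powerset.2 inter_subset_right)
      fun L hL => ?_).resolve_left h1).resolve_left h2
    have := inter_eq_right.2 (mem_powerset.1 (fano_subset hL))
    rw [inter_assoc, this]
    exact hblock E hE L hL
  have hsum := sum_card_inter_le hD (ground 7)
  rw [card_ground, hunion, sum_union hdC, sum_union hdAB] at hsum
  have sa : ∑ E ∈ Fa, #(E ∩ ground 7) = #Fa * 3 :=
    sum_const_nat fun E hE => card_of_mem_fano _ (mem_filter.1 hE).2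
  have sb : ∑ E ∈ Fb, #(E ∩ ground 7) = #Fb * 4 :=
    sum_const_nat fun E hE => card_of_mem_fanoPlus_sdiff _ (mem_filter.1 hE).2
  have sc : #Fc * 5 ≤ ∑ E ∈ Fc, #(E ∩ ground 7) := by
    rw [← smul_eq_mul]
    exact card_nsmul_le_sum _ _ 5 hmem
  refine ⟨#Fa, #Fb, #Fc, ?_, by omega, ?_, ?_, fun ha hb hc => ?_, fun ha hb hc => ?_⟩
  · rw [← card_union_of_disjoint hdAB, ← card_union_of_disjoint hdC, ← hunion]
  · exact card_fanoFamily (r := r) hn ▸ card_le_card hsubA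
  · exact card_fanoPlus_sdiff_family (r := r) hn ▸ card_le_card hsubB
  · have e1 := eq_of_subset_of_card_le hsubA (by rw [ha, card_fanoFamily hn])
    have e2 := eq_of_subset_of_card_le hsubB (by rw [hb, card_fanoPlus_sdiff_family hn])
    rw [hunion, card_eq_zero.1 hc, union_empty, e1, e2, fanoPlusFamily, fanoFamily,
      ← traceFamily_union, ← fanoPlus_eq]
  · have e1 := eq_of_subset_of_card_le hsubA (by rw [ha, card_fanoFamily hn])
    rw [hunion, card_eq_zero.1 hb, card_eq_zero.1 hc, union_empty, union_empty, e1]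

/-! ### The structure of families of large weighted diversity -/

theorem exists_subset_pair {S : Finset ℕ} (h : #S ≤ 2) : ∃ x y, S ⊆ {x, y} := by
  rcases S.eq_empty_or_nonempty with rfl | ⟨x, hx⟩
  · exact ⟨0, 0, empty_subset _⟩
  · have h1 : #(S.erase x) ≤ 1 := by
      rw [card_erase_of_mem hx]
      omega
    obtain ⟨y, hy⟩ := card_le_one_iff_subset_singleton.1 h1
    exact ⟨x, y, (insert_erase hx).symm.subset.trans (insert_subset_insert _ hy)⟩

/-- C is the convex combination of 3/2 and 7/3 with weights (2/5)(7 - 3C) and (6C - 9)/5. Combining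
the two bounds gives 0.92(7 - 3C)N, and the slack absorbs εN. -/
theorem sub_mul_lt_of_bounds {C f f' D N ε : ℝ} (hC : 3 / 2 ≤ C) (hC' : C < 7 / 3) (hN : 0 < N)
    (hε : ε ≤ (7 - 3 * C) / 200) (h1 : f' - 3 / 2 * D ≤ 23 / 10 * N) (h2 : f' ≤ 7 / 3 * D)
    (hf : f ≤ f' + ε * N) : f - C * D < (7 - 3 * C) * N := by
  have e1 : 2 / 5 * (7 - 3 * C) * (f' - 3 / 2 * D) ≤ 2 / 5 * (7 - 3 * C) * (23 / 10 * N) :=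
    mul_le_mul_of_nonneg_left h1 (by linarith)
  have e2 : (6 * C - 9) / 5 * (f' - 7 / 3 * D) ≤ 0 :=
    mul_nonpos_of_nonneg_of_nonpos (by linarith) (by linarith)
  have e3 : ε * N ≤ (7 - 3 * C) / 200 * N := mul_le_mul_of_nonneg_right hε hN.le
  have e4 : 0 < (7 - 3 * C) * N := mul_pos (by linarith) hN
  have e5 : f' - C * D = 2 / 5 * (7 - 3 * C) * (f' - 3 / 2 * D) +
    (6 * C - 9) / 5 * (f' - 7 / 3 * D) := by ring
  linarith

/-- The 20 triples form ten complementary pairs, and `T` contains at most one from each. -/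
theorem card_six_point_triples {T : Finset (Finset ℕ)} {W : Finset ℕ} (hW : #W = 6)
    (hT : T ⊆ powersetCard 3 W) (hi : ∀ A ∈ T, ∀ B ∈ T, (A ∩ B).Nonempty) :
    #T ≤ 10 ∧ (#T = 10 → ∀ A ∈ powersetCard 3 W, A ∉ T → W \ A ∈ T) := by
  have hsub : T.image (W \ ·) ⊆ powersetCard 3 W \ T := by
    intro A hA
    obtain ⟨B, hB, rfl⟩ := mem_image.1 hA
    obtain ⟨hBW, hB3⟩ := mem_powersetCard.1 (hT hB)
    refine mem_sdiff.2 ⟨mem_powersetCard.2 ⟨sdiff_subset, ?_⟩, fun h => ?_⟩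
    · rw [card_sdiff_of_subset hBW, hW, hB3]
    · obtain ⟨x, hx⟩ := hi B hB _ h
      exact (mem_sdiff.1 (mem_inter.1 hx).2).2 (mem_inter.1 hx).1
  have hcard : #(T.image (W \ ·)) = #T := by
    refine card_image_of_injOn fun A hA B hB hAB => ?_
    have hA' := (mem_powersetCard.1 (hT (mem_coe.1 hA))).1
    have hB' := (mem_powersetCard.1 (hT (mem_coe.1 hB))).1
    rw [← Finset.sdiff_sdiff_eq_self hA', show W \ A = W \ B from hAB,
      Finset.sdiff_sdiff_eq_self hB']
  have h20 : #(powersetCard 3 W \ T) + #T = 20 := by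
    rw [card_sdiff_add_card_eq_card hT, card_powersetCard, hW]
    rfl
  have hle := card_le_card hsub
  refine ⟨by omega, fun h10 A hA hAT => ?_⟩
  have heq := eq_of_subset_of_card_le hsub (by omega)
  have : A ∈ T.image (W \ ·) := heq ▸ mem_sdiff.2 ⟨hA, hAT⟩
  obtain ⟨B, hB, rfl⟩ := mem_image.1 this
  rwa [Finset.sdiff_sdiff_eq_self (mem_powersetCard.1 (hT hB)).1]

theorem fano_covers : ∀ i ∈ ground 7, ∃ L ∈ fano, i ∈ L := by decide +kernel

/-- Extend the labelling to a permutation of [n] and apply its inverse, which moves the plane to its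
standard position. -/
theorem isomorphic_of_fano_labelling {n r : ℕ} (hn : 7 ≤ n) {F : Finset (Finset ℕ)}
    (hF : F ⊆ powersetCard r (ground n)) {v : ℕ → ℕ} (hv : Set.InjOn v (ground 7))
    (hvn : ∀ L ∈ fano, L.image v ⊆ ground n)
    (hmeet : ∀ E ∈ F, ∀ L ∈ fano, (E ∩ L.image v).Nonempty) :
    ∃ G, Isomorphic n F G ∧ G ⊆ powersetCard r (ground n) ∧
      ∀ E ∈ G, ∀ L ∈ fano, (E ∩ L).Nonempty := by
  obtain ⟨σ, hσ, hσv⟩ := exists_perm_extending hn hv fun i hi => by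
    obtain ⟨L, hL, hiL⟩ := fano_covers i hi
    exact hvn L hL (mem_image_of_mem v hiL)
  have hσ' : (ground n).image σ.symm = ground n := by
    conv_lhs => rw [← hσ]
    rw [image_image, Equiv.symm_comp_self, image_id]
  refine ⟨F.image fun E => E.image σ.symm, ⟨σ.symm, hσ', rfl⟩, ?_, ?_⟩
  · intro A hA
    obtain ⟨E, hE, rfl⟩ := mem_image.1 hA
    obtain ⟨h1, h2⟩ := mem_powersetCard.1 (hF hE)
    refine mem_powersetCard.2 ⟨?_, ?_⟩
    · rw [← hσ']
      exact image_subset_image h1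
    · rw [card_image_of_injective _ σ.symm.injective, h2]
  · intro A hA L hL
    obtain ⟨E, hE, rfl⟩ := mem_image.1 hA
    obtain ⟨w, hw⟩ := hmeet E hE L hL
    obtain ⟨hwE, hwL⟩ := mem_inter.1 hw
    obtain ⟨i, hi, rfl⟩ := mem_image.1 hwL
    refine ⟨i, mem_inter.2 ⟨mem_image.2 ⟨v i, hwE, ?_⟩, hi⟩⟩
    rw [← hσv i (mem_powerset.1 (fano_subset hL) hi), Equiv.symm_apply_apply]

/-- Each member meets W in four points, up to a deficit of one for members with trace in `T`. No
error term εN enters, as the tie at C = 3/2 requires. -/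
theorem six_points_exact_bound {n r D : ℕ} {F T : Finset (Finset ℕ)} {W : Finset ℕ}
    (hF : F ⊆ powersetCard r (ground n)) (hW : #W = 6) (hWn : W ⊆ ground n)
    (hT : T ⊆ powersetCard 3 W) (hT10 : #T ≤ 10) (hD : ∀ x, degree F x ≤ D)
    (hFW : ∀ E ∈ F, E ∩ W ∈ T ∨ 4 ≤ #(E ∩ W)) :
    4 * #F ≤ 6 * D + 10 * binom (n - 6) ((r : ℤ) - 3) := by
  have hsum := sum_card_inter_le hD W
  rw [hW] at hsum
  have hlow : 4 * #F ≤ ∑ E ∈ F, #(E ∩ W) + #{E ∈ F | E ∩ W ∈ T} := by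
    rw [card_filter, ← sum_add_distrib, mul_comm, ← smul_eq_mul]
    refine card_nsmul_le_sum _ _ 4 fun E hE => ?_
    split_ifs with h
    · rw [(mem_powersetCard.1 (hT h)).2]
    · exact (hFW E hE).resolve_left h
  have hcount : #{E ∈ F | E ∩ W ∈ T} ≤ 10 * binom (n - 6) ((r : ℤ) - 3) := by
    have : #{E ∈ F | E ∩ W ∈ T} ≤ #T * binom (n - 6) ((r : ℤ) - 3) := by
      rw [mul_comm]
      refine card_le_mul_card_image_of_maps_to (f := (· ∩ W))
        (fun E hE => (mem_filter.1 hE).2) _ fun A hA => ?_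
      obtain ⟨hAW, hA3⟩ := mem_powersetCard.1 (hT hA)
      have := card_trace_eq (r := r) hWn hAW
      rw [hW, hA3] at this
      refine le_trans (card_le_card fun E hE => ?_) this.le
      obtain ⟨h1, h2⟩ := mem_filter.1 hE
      exact mem_filter.2 ⟨hF (mem_filter.1 h1).1, h2⟩
    exact this.trans (Nat.mul_le_mul_right _ hT10)
  omega

/-- The middle alternative is the ten-triple configuration on six points, which first-order
estimates cannot separate from the Fano plane at C = 3/2. -/
theorem structure_of_large_diversity (r : ℕ) (hr : 3 ≤ r) {C : ℝ} (hC : 3 / 2 ≤ C)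
    (hC' : C < 7 / 3) : ∃ n₀ : ℕ, ∀ n ≥ n₀, ∀ F, IsIntersectingFamily n r F →
      diversity n C F < (7 - 3 * C) * binom (n - 7) ((r : ℤ) - 3) ∨
      (C = 3 / 2 ∧ diversity n C F ≤ 5 / 2 * binom (n - 6) ((r : ℤ) - 3)) ∨
      ∃ G, Isomorphic n F G ∧ G ⊆ powersetCard r (ground n) ∧
        ∀ E ∈ G, ∀ L ∈ fano, (E ∩ L).Nonempty := by
  obtain ⟨ε, hε, hε1, hε2⟩ : ∃ ε : ℝ, 0 < ε ∧ ε ≤ (7 - 3 * C) / 200 ∧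
      (C ≠ 3 / 2 → ε ≤ (2 * C - 3) / 10) := by
    by_cases h : C = 3 / 2
    · exact ⟨(7 - 3 * C) / 200, by linarith, le_rfl, fun h' => absurd h h'⟩
    · have : 3 / 2 < C := lt_of_le_of_ne hC (Ne.symm h)
      exact ⟨min ((7 - 3 * C) / 200) ((2 * C - 3) / 10),
        lt_min (by linarith) (by linarith), min_le_left _ _, fun _ => min_le_right _ _⟩
  obtain ⟨M, hM⟩ := exists_kernel r
  -- The two extra points allow a two-point cover to be added to the kernel.
  obtain ⟨n₀, hn₀⟩ := eventually_small r hr (M + 2) ε hε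
  refine ⟨n₀, fun n hn F hF => ?_⟩
  obtain ⟨hnr, hN0, hN1, hsmall⟩ := hn₀ n hn
  obtain ⟨J, hJM, hker⟩ := hM n F hF
  set D := maxDegree n F with hDdef
  have hDF : ∀ x, degree F x ≤ D := degree_le_maxDegree hF.1
  set N0 := binom (n - 7) ((r : ℤ) - 3) with hN0def
  set N1 := binom (n - 3) ((r : ℤ) - 3) with hN1def
  have hN0' : (0 : ℝ) < N0 := by exact_mod_cast hN0
  set F' := {E ∈ F | ¬ 4 ≤ #(E ∩ J)} with hF'def
  have hF'F : F' ⊆ F := filter_subset _ _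
  have hDF' : ∀ x, degree F' x ≤ D := fun x => (degree_mono hF'F x).trans (hDF x)
  have hker' : ∀ E ∈ F', ∀ E' ∈ F', (E ∩ E' ∩ J).Nonempty :=
    fun E hE E' hE' => hker E (hF'F hE) E' (hF'F hE')
  have hsup : ∀ A : Finset ℕ, #A = 3 → #{E ∈ F' | A ⊆ E} ≤ N1 := by
    intro A hA
    have := card_superset_le (hF'F.trans hF.1) A
    rwa [hA] at this
  have hff : (#F : ℝ) ≤ #F' + ε * N0 := by
    have h1 := card_filter_add_card_filter_not (s := F) (fun E => 4 ≤ #(E ∩ J))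
    have h2 := hsmall F hF.1 J (by omega)
    have h3 : (#{E ∈ F | 4 ≤ #(E ∩ J)} : ℝ) + #F' = #F := by exact_mod_cast h1
    linarith
  have hN1' : (N1 : ℝ) ≤ 81 / 80 * N0 := by
    have : ε * N0 ≤ 1 / 80 * N0 := by
      refine mul_le_mul_of_nonneg_right ?_ hN0'.le
      linarith
    linarith
  have hεN : ε * N0 ≤ 1 / 80 * N0 := by
    refine mul_le_mul_of_nonneg_right ?_ hN0'.le
    linarith
  have finish : (#F' : ℝ) - 3 / 2 * D ≤ 23 / 10 * N0 → (#F' : ℝ) ≤ 7 / 3 * D →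
      diversity n C F < (7 - 3 * C) * N0 :=
    fun h1 h2 => sub_mul_lt_of_bounds hC hC' hN0' hε1 h1 h2 hff
  by_cases hcov : ∃ x y, ∀ E ∈ F', x ∈ E ∨ y ∈ E
  · obtain ⟨x, y, hxy⟩ := hcov
    obtain ⟨h1, h2⟩ := two_cover_bound (F := F') (J := insert x (insert y J)) (by simp) (by simp)
      (fun E hE E' hE' => (hker' E hE E' hE').mono (inter_subset_inter_left
        ((subset_insert _ _).trans (subset_insert _ _)))) hxy hsup hDF'
    have h3 := hsmall F' (hF'F.trans hF.1) (insert x (insert y J))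
      ((card_insert_le _ _).trans (Nat.succ_le_succ ((card_insert_le _ _).trans
        (Nat.succ_le_succ hJM))))
    have h1' : (2 : ℝ) * #F' ≤ 3 * D + 4 * N1 +
        2 * #{E ∈ F' | 4 ≤ #(E ∩ insert x (insert y J))} := by exact_mod_cast h1
    have h2' : (#F' : ℝ) ≤ 2 * D := by exact_mod_cast h2
    have : (0 : ℝ) ≤ D := Nat.cast_nonneg D
    exact Or.inl (finish (by linarith) (by linarith))
  push Not at hcov
  have hge3 : ∀ E ∈ F, 3 ≤ #(E ∩ J) := by
    intro E hE
    by_contra! hlt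
    obtain ⟨x, y, hxy⟩ := exists_subset_pair (S := E ∩ J) (by omega)
    obtain ⟨E', hE', hx, hy⟩ := hcov x y
    obtain ⟨w, hw⟩ := hker E hE E' (hF'F hE')
    simp only [mem_inter] at hw
    have := hxy (mem_inter.2 ⟨hw.1.1, hw.2⟩)
    simp only [mem_insert, mem_singleton] at this
    rcases this with rfl | rfl
    · exact hx hw.1.2
    · exact hy hw.1.2
  have h3 : ∀ E ∈ F', #(E ∩ J) = 3 := by
    intro E hE
    have := hge3 E (hF'F hE)
    have := (mem_filter.1 hE).2
    omega
  set T := F'.image (· ∩ J) with hTdef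
  have hT3 : ∀ A ∈ T, #A = 3 := by
    intro A hA
    obtain ⟨E, hE, rfl⟩ := mem_image.1 hA
    exact h3 E hE
  have hFT : ∀ E ∈ F, ∀ A ∈ T, (E ∩ A).Nonempty := by
    intro E hE A hA
    obtain ⟨E', hE', rfl⟩ := mem_image.1 hA
    rw [← inter_assoc]
    exact hker E hE E' (hF'F hE')
  have hTi : ∀ A ∈ T, ∀ B ∈ T, (A ∩ B).Nonempty := by
    intro A hA B hB
    obtain ⟨E, hE, rfl⟩ := mem_image.1 hA
    obtain ⟨E', hE', rfl⟩ := mem_image.1 hB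
    obtain ⟨w, hw⟩ := hker' E hE E' hE'
    simp only [mem_inter] at hw
    exact ⟨w, by simp [hw]⟩
  have hTcov : ∀ x y, ∃ A ∈ T, x ∉ A ∧ y ∉ A := by
    intro x y
    obtain ⟨E, hE, hx, hy⟩ := hcov x y
    exact ⟨E ∩ J, mem_image_of_mem _ hE, fun h => hx (mem_inter.1 h).1,
      fun h => hy (mem_inter.1 h).1⟩
  have hTn : ∀ A ∈ T, A ⊆ ground n := by
    intro A hA
    obtain ⟨E, hE, rfl⟩ := mem_image.1 hA
    exact inter_subset_left.trans (mem_powersetCard.1 (hF.1 (hF'F hE))).1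
  have hTN : ∀ A ∈ T, #{E ∈ F' | E ∩ J = A} ≤ N1 := by
    intro A hA
    refine (card_le_card fun E hE => ?_).trans (hsup A (hT3 A hA))
    obtain ⟨hE', rfl⟩ := mem_filter.1 hE
    exact mem_filter.2 ⟨hE', inter_subset_left⟩
  by_cases h6 : #T ≤ 6
  · obtain ⟨h1, h2⟩ := few_traces_bound hker' h3 hTN hDF' h6
    have h1' : (2 : ℝ) * #F' ≤ 3 * D + 4 * N1 := by exact_mod_cast h1
    have h2' : (3 : ℝ) * #F' ≤ 7 * D := by exact_mod_cast h2
    exact Or.inl (finish (by linarith) (by linarith))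
  by_cases hnl : ∃ A ∈ T, ∃ B ∈ T, A ≠ B ∧ ∃ a b, a ≠ b ∧ a ∈ A ∧ a ∈ B ∧ b ∈ A ∧ b ∈ B
  · have : (0 : ℝ) ≤ D := Nat.cast_nonneg D
    rcases six_points_or_quad hT3 hTi hTcov hnl with ⟨W₀, hW₀, hTW₀⟩ | ⟨Q, hQ, hTQ⟩
    · obtain ⟨W, hW₀W, hWn, hW⟩ := exists_subsuperset_card_eq
        (inter_subset_right : W₀ ∩ ground n ⊆ ground n)
        ((card_le_card inter_subset_left).trans hW₀) (by rw [card_ground]; omega)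
      have hTW : T ⊆ powersetCard 3 W := fun A hA => mem_powersetCard.2
        ⟨(subset_inter (hTW₀ A hA) (hTn A hA)).trans hW₀W, hT3 A hA⟩
      have hf2 : #F' ≤ 2 * D := six_points_bound h3 hDF' hW.le fun E hE =>
        (mem_powersetCard.1 (hTW (mem_image_of_mem _ hE))).1
      have hf2' : (#F' : ℝ) ≤ 2 * D := by exact_mod_cast hf2
      have hfT := card_le_card_traces_mul hTN
      obtain ⟨h10, hcompl⟩ := card_six_point_triples hW hTW hTi
      -- From |F'| ≤ 2D follows |F'| - (3/2)D ≤ |F'|/4. Nine traces give at most (9/4)(81/80)N <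
      -- 2.3N, the tightest use of the constant 23/10; ten would give about (5/2)N.
      by_cases h9 : #T ≤ 9
      · have : (#F' : ℝ) ≤ 9 * N1 := by
          exact_mod_cast hfT.trans (Nat.mul_le_mul_right _ h9)
        exact Or.inl (finish (by linarith) (by linarith))
      · have hf10 : (#F' : ℝ) ≤ 10 * N1 := by
          exact_mod_cast hfT.trans (Nat.mul_le_mul_right _ h10)
        by_cases hC32 : C = 3 / 2
        · refine Or.inr (Or.inl ⟨hC32, ?_⟩)
          have hex := six_points_exact_bound (r := r) hF.1 hW hWn hTW h10 hDF
            fun E hE => by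
              by_contra! hno
              have hmeet : ∀ A ∈ T, ∃ w ∈ E ∩ W, w ∈ A := by
                intro A hA
                obtain ⟨w, hw⟩ := hFT E hE A hA
                rw [mem_inter] at hw
                exact ⟨w, mem_inter.2 ⟨hw.1, (mem_powersetCard.1 (hTW hA)).1 hw.2⟩, hw.2⟩
              -- With ten triples present, a trace outside `T` has its complement in `T`, which E
              -- would miss; a smaller trace would give a two-point cover.
              by_cases hE3 : #(E ∩ W) = 3
              · obtain ⟨w, hw, hw'⟩ := hmeet _ (hcompl (by omega) _
                  (mem_powersetCard.2 ⟨inter_subset_right, hE3⟩) hno.1)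
                exact (mem_sdiff.1 hw').2 hw
              · obtain ⟨x, y, hxy⟩ := exists_subset_pair (S := E ∩ W) (by omega)
                obtain ⟨A, hA, hxA, hyA⟩ := hTcov x y
                obtain ⟨w, hw, hwA⟩ := hmeet A hA
                have := hxy hw
                simp only [mem_insert, mem_singleton] at this
                rcases this with rfl | rfl
                · exact hxA hwA
                · exact hyA hwA
          have hex' : (4 : ℝ) * #F ≤ 6 * D + 10 * binom (n - 6) ((r : ℤ) - 3) := by
            exact_mod_cast hex
          rw [diversity, hC32, ← hDdef]
          linarith
        -- For C > 3/2 the ten triples contribute about (10 - 5C)N when C ≤ 2, short of (7 - 3C)N by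
        -- (2C - 3)N; for C > 2 the main term is not positive.
        · refine Or.inl ?_
          have hε3 := hε2 hC32
          rw [diversity, ← hDdef]
          have e1 : ε * N0 ≤ (2 * C - 3) / 10 * N0 := mul_le_mul_of_nonneg_right hε3 hN0'.le
          have e2 : ε * N0 ≤ (7 - 3 * C) / 200 * N0 := mul_le_mul_of_nonneg_right hε1 hN0'.le
          have e3 : 0 < (2 * C - 3) * N0 := mul_pos (by linarith) hN0'
          have e4 : 0 < (7 - 3 * C) * N0 := mul_pos (by linarith) hN0'
          have e5 : 0 ≤ C * (2 * D - #F') := mul_nonneg (by linarith) (by linarith)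
          by_cases hC2 : C ≤ 2
          · have e6 : (2 - C) * #F' ≤ (2 - C) * (10 * ((1 + ε) * N0)) :=
              mul_le_mul_of_nonneg_left (by linarith) (by linarith)
            have e7 : (2 - C) * (ε * N0) ≤ 1 / 2 * (ε * N0) :=
              mul_le_mul_of_nonneg_right (by linarith) (by positivity)
            linarith
          · have e6 : 0 ≤ (C - 2) * #F' := mul_nonneg (by linarith) (Nat.cast_nonneg _)
            linarith
    · obtain ⟨h1, h2⟩ := quad_bound hker' h3 hTN hDF' hcov hQ fun E hE =>
        hTQ _ (mem_image_of_mem _ hE)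
      have h1' : (2 : ℝ) * #F' ≤ 3 * D + 3 * N1 := by exact_mod_cast h1
      have h2' : (#F' : ℝ) ≤ 2 * D := by exact_mod_cast h2
      exact Or.inl (finish (by linarith) (by linarith))
  · push Not at hnl
    obtain ⟨v, hv, hvT⟩ := linear_eq_fano hT3 hTi hTcov (fun A hA B hB hAB x y hxA hxB hyA hyB =>
      by_contra fun hxy => hnl A hA B hB hAB x y hxy hxA hxB hyA hyB) (by omega)
    have hLT : ∀ L ∈ fano, L.image v ∈ T := fun L hL => hvT ▸ mem_image_of_mem _ hL
    exact Or.inr (Or.inr (isomorphic_of_fano_labelling (by omega) hF.1 hv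
      (fun L hL => hTn _ (hLT L hL)) fun E hE L hL => hFT E hE _ (hLT L hL)))

/-! ### Values attained by the two extremal families -/

theorem diversity_trace_families (r : ℕ) (hr : 3 ≤ r) : ∃ n₀ : ℕ, ∀ n ≥ n₀, ∀ C : ℝ,
    diversity n C (fanoFamily n r) = (7 - 3 * C) * binom (n - 7) ((r : ℤ) - 3) ∧
    diversity n C (fanoPlusFamily n r) = (7 - 3 * C) * binom (n - 7) ((r : ℤ) - 3) +
      (28 - 16 * C) * binom (n - 7) ((r : ℤ) - 4) := by
  obtain ⟨n₀, hn₀⟩ := eventually_small r hr 8 1 one_pos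
  refine ⟨n₀, fun n hn C => ?_⟩
  obtain ⟨hnr, -, -, hsmall⟩ := hn₀ n hn
  have hn7 : 7 ≤ n := by omega
  have hsm : ∀ B : Finset (Finset ℕ), ∀ J : Finset ℕ, #J ≤ 8 →
      #{E ∈ traceFamily n r B | 4 ≤ #(E ∩ J)} ≤ binom (n - 7) ((r : ℤ) - 3) := by
    intro B J hJ
    have := hsmall (traceFamily n r B) (filter_subset _ _) J hJ
    rw [one_mul] at this
    exact_mod_cast this
  have hP3 : ∀ A ∈ fanoPlus, 3 ≤ #A := by
    intro A hA
    rw [fanoPlus_eq, mem_union] at hA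
    rcases hA with hA | hA
    · exact (card_of_mem_fano A hA).ge
    · rw [card_of_mem_fanoPlus_sdiff A hA]
      norm_num
  have m1 : maxDegree n (fanoFamily n r) = 3 * binom (n - 7) ((r : ℤ) - 3) :=
    maxDegree_traceFamily hn7 (fun A hA => (card_of_mem_fano A hA).ge)
      (fun x hx => degree_fanoFamily hn7 hx) fun J hJ => (hsm _ J hJ).trans (by omega)
  have m2 : maxDegree n (fanoPlusFamily n r) =
      3 * binom (n - 7) ((r : ℤ) - 3) + 16 * binom (n - 7) ((r : ℤ) - 4) :=
    maxDegree_traceFamily hn7 hP3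
      (fun x hx => degree_fanoPlusFamily hn7 hx) fun J hJ => (hsm _ J hJ).trans (by omega)
  rw [diversity, diversity, m1, m2, card_fanoFamily hn7, card_fanoPlusFamily hn7]
  push_cast
  constructor <;> ring

theorem binom_six_eq {n r : ℕ} (hr : 3 ≤ r) (hn : 7 ≤ n) :
    binom (n - 6) ((r : ℤ) - 3) =
      binom (n - 7) ((r : ℤ) - 3) + binom (n - 7) ((r : ℤ) - 4) := by
  have h3 : ∀ m, binom m ((r : ℤ) - 3) = m.choose (r - 3) := fun m => binom_sub m hr
  rw [h3, h3]
  rcases hr.eq_or_lt with rfl | hr4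
  · simp [binom]
  · have h4 : binom (n - 7) ((r : ℤ) - 4) = (n - 7).choose (r - 4) := binom_sub _ hr4
    obtain ⟨s, rfl⟩ : ∃ s, r = s + 4 := ⟨r - 4, by omega⟩
    obtain ⟨m, rfl⟩ : ∃ m, n = m + 7 := ⟨n - 7, by omega⟩
    rw [h4, add_comm (Nat.choose _ _)]
    exact Nat.choose_succ_succ' m s

theorem binom_four_pos {n r : ℕ} (hr : 4 ≤ r) (hn : r + 7 ≤ n) :
    0 < binom (n - 7) ((r : ℤ) - 4) := by
  have h4 : binom (n - 7) ((r : ℤ) - 4) = (n - 7).choose (r - 4) := binom_sub _ hr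
  rw [h4]
  exact Nat.choose_pos (by omega)

end WeightedDiversity

/-! ### The two ranges of C -/

theorem corollary1p3 (r : ℕ) (hr : 3 ≤ r) (C : ℝ) :
    (3 / 2 ≤ C → C < 7 / 4 →
      ∃ n₀ : ℕ, ∀ n : ℕ, n₀ ≤ n → ∀ F : Finset (Finset ℕ), IsIntersectingFamily n r F →
        diversity n C F ≤ (7 - 3 * C) * (binom (n - 7) ((r : ℤ) - 3) : ℝ)
            + (28 - 16 * C) * (binom (n - 7) ((r : ℤ) - 4) : ℝ) ∧
        (Isomorphic n F (fanoPlusFamily n r) →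
          diversity n C F = (7 - 3 * C) * (binom (n - 7) ((r : ℤ) - 3) : ℝ)
            + (28 - 16 * C) * (binom (n - 7) ((r : ℤ) - 4) : ℝ)) ∧
        (¬ (r = 3 ∧ C = 3 / 2) →
          diversity n C F = (7 - 3 * C) * (binom (n - 7) ((r : ℤ) - 3) : ℝ)
            + (28 - 16 * C) * (binom (n - 7) ((r : ℤ) - 4) : ℝ) →
          Isomorphic n F (fanoPlusFamily n r))) ∧
    (7 / 4 ≤ C → C < 7 / 3 →
      ∃ n₀ : ℕ, ∀ n : ℕ, n₀ ≤ n → ∀ F : Finset (Finset ℕ), IsIntersectingFamily n r F →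
        diversity n C F ≤ (7 - 3 * C) * (binom (n - 7) ((r : ℤ) - 3) : ℝ) ∧
        (C ≠ 7 / 4 →
          (diversity n C F = (7 - 3 * C) * (binom (n - 7) ((r : ℤ) - 3) : ℝ) ↔
            Isomorphic n F (fanoFamily n r)))) := by
  obtain ⟨n₁, hn₁⟩ := diversity_trace_families r hr
  constructor
  · intro hC hC'
    obtain ⟨n₂, hn₂⟩ := structure_of_large_diversity r hr hC (by linarith)
    refine ⟨max (max n₁ n₂) (r + 7), fun n hn F hF => ?_⟩
    have hd := (hn₁ n (by omega) C).2
    have hs := hn₂ n (by omega) F hF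
    have hsix := binom_six_eq (n := n) hr (by omega)
    have hpos := fun h : 4 ≤ r => binom_four_pos (n := n) h (by omega)
    have hcount := fun G hG hG' => fano_count (n := n) (r := r) (F := G) (by omega) hG hG'
      (degree_le_maxDegree hG)
    generalize binom (n - 7) ((r : ℤ) - 3) = N at *
    generalize binom (n - 7) ((r : ℤ) - 4) = B at *
    have hB0 : 0 ≤ (28 - 16 * C) * (B : ℝ) := mul_nonneg (by linarith) (Nat.cast_nonneg _)
    have iso_eq : Isomorphic n F (fanoPlusFamily n r) →
        diversity n C F = (7 - 3 * C) * N + (28 - 16 * C) * B :=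
      fun h => (h.diversity_eq C).trans hd
    rcases hs with hs | ⟨rfl, hs⟩ | ⟨G, hiso, hG, hblock⟩
    · exact ⟨by linarith, iso_eq, fun _ h => by linarith⟩
    -- The bound is now (5/2)(N + B), below the target (5/2)N + 4B unless B = 0, which needs r = 3.
    · rw [hsix] at hs
      push_cast at hs
      have hB : (0 : ℝ) ≤ B := Nat.cast_nonneg _
      refine ⟨by linarith, iso_eq, fun h3 h => ?_⟩
      have h4 : 4 ≤ r := by
        by_contra hlt
        exact h3 ⟨by omega, rfl⟩
      have : (0 : ℝ) < B := by exact_mod_cast hpos h4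
      linarith
    · obtain ⟨a, b, c, hf, hD, ha, hb, hplus, -⟩ := hcount G hG hblock
      have hdiv := hiso.diversity_eq C
      have hf' : (Finset.card G : ℝ) = a + b + c := by exact_mod_cast hf
      have hD' : (3 : ℝ) * a + 4 * b + 5 * c ≤ 7 * maxDegree n G := by exact_mod_cast hD
      have ha' : (a : ℝ) ≤ 7 * N := by exact_mod_cast ha
      have hb' : (b : ℝ) ≤ 28 * B := by exact_mod_cast hb
      have hc' : (0 : ℝ) ≤ c := Nat.cast_nonneg _
      -- These four slacks add up to 7 times the gap in the claimed bound, so equality makes each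
      -- vanish. Here 7 - 4C > 0 forces b to be maximal, and 5C > 7 forces c = 0.
      have e1 : 0 ≤ C * (7 * maxDegree n G - (3 * a + 4 * b + 5 * c)) :=
        mul_nonneg (by linarith) (by linarith)
      have e2 : 0 ≤ (7 - 3 * C) * (7 * N - a) := mul_nonneg (by linarith) (by linarith)
      have e3 : 0 ≤ (7 - 4 * C) * (28 * B - b) := mul_nonneg (by linarith) (by linarith)
      have e4 : 0 ≤ (5 * C - 7) * c := mul_nonneg (by linarith) hc'
      rw [diversity, diversity, hf'] at hdiv
      rw [diversity] at iso_eq ⊢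
      refine ⟨by linarith, iso_eq, fun _ h => ?_⟩
      have z2 : (7 - 3 * C) * (7 * N - a) = 0 := by linarith
      have z3 : (7 - 4 * C) * (28 * B - b) = 0 := by linarith
      have z4 : (5 * C - 7) * (c : ℝ) = 0 := by linarith
      have w2 := (mul_eq_zero.1 z2).resolve_left (by linarith)
      have w3 := (mul_eq_zero.1 z3).resolve_left (by linarith)
      have w4 := (mul_eq_zero.1 z4).resolve_left (by linarith)
      have x2 : a = 7 * N := by
        have : (a : ℝ) = 7 * N := by linarith
        exact_mod_cast this
      have x3 : b = 28 * B := by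
        have : (b : ℝ) = 28 * B := by linarith
        exact_mod_cast this
      exact hplus x2 x3 (by exact_mod_cast w4) ▸ hiso
  · intro hC hC'
    obtain ⟨n₂, hn₂⟩ := structure_of_large_diversity r hr (by linarith) hC'
    refine ⟨max (max n₁ n₂) (r + 7), fun n hn F hF => ?_⟩
    have hd := (hn₁ n (by omega) C).1
    have hs := hn₂ n (by omega) F hF
    have hcount := fun G hG hG' => fano_count (n := n) (r := r) (F := G) (by omega) hG hG'
      (degree_le_maxDegree hG)
    generalize binom (n - 7) ((r : ℤ) - 3) = N at *
    have iso_eq : Isomorphic n F (fanoFamily n r) → diversity n C F = (7 - 3 * C) * N :=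
      fun h => (h.diversity_eq C).trans hd
    rcases hs with hs | ⟨rfl, -⟩ | ⟨G, hiso, hG, hblock⟩
    · exact ⟨hs.le, fun _ => ⟨fun h => absurd h hs.ne, iso_eq⟩⟩
    · norm_num at hC
    · obtain ⟨a, b, c, hf, hD, ha, -, -, hfano⟩ := hcount G hG hblock
      have hdiv := hiso.diversity_eq C
      have hf' : (Finset.card G : ℝ) = a + b + c := by exact_mod_cast hf
      have hD' : (3 : ℝ) * a + 4 * b + 5 * c ≤ 7 * maxDegree n G := by exact_mod_cast hD
      have ha' : (a : ℝ) ≤ 7 * N := by exact_mod_cast ha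
      -- The coefficient of b has changed sign: equality now forces b = 0, except at C = 7/4, where
      -- b is free.
      have e1 : 0 ≤ C * (7 * maxDegree n G - (3 * a + 4 * b + 5 * c)) :=
        mul_nonneg (by linarith) (by linarith)
      have e2 : 0 ≤ (7 - 3 * C) * (7 * N - a) := mul_nonneg (by linarith) (by linarith)
      have e3 : 0 ≤ (4 * C - 7) * (b : ℝ) := mul_nonneg (by linarith) (Nat.cast_nonneg _)
      have e4 : 0 ≤ (5 * C - 7) * (c : ℝ) := mul_nonneg (by linarith) (Nat.cast_nonneg _)
      rw [diversity, diversity, hf'] at hdiv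
      rw [diversity] at iso_eq ⊢
      refine ⟨by linarith, fun hC4 => ⟨fun h => ?_, iso_eq⟩⟩
      have z2 : (7 - 3 * C) * (7 * N - a) = 0 := by linarith
      have z3 : (4 * C - 7) * (b : ℝ) = 0 := by linarith
      have z4 : (5 * C - 7) * (c : ℝ) = 0 := by linarith
      have w2 := (mul_eq_zero.1 z2).resolve_left (by linarith)
      have w3 := (mul_eq_zero.1 z3).resolve_left fun h => hC4 (by linarith)
      have w4 := (mul_eq_zero.1 z4).resolve_left (by linarith)
      have x2 : a = 7 * N := by
        have : (a : ℝ) = 7 * N := by linarith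
        exact_mod_cast this
      exact hfano x2 (by exact_mod_cast w3) (by exact_mod_cast w4) ▸ hiso
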